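/- **Lemma 1.5.** Let $(F,\nu)$ be a $\sigma$-finite measure space, $\mathcal H$ a separable complex Hilbert space, $g:F\times F\to\mathbb C$ a measurable function, and $(S_x)_{x\in F}$ a measurable family of bounded operators on $\mathcal H$ (that is, $x\mapsto\langle u,S_xv\rangle$ is measurable for all $u,v\in\mathcal H$). Let $L^2(F,\nu)\hat\otimes\mathcal H$ be the Hilbert space tensor product; its elements are evaluated at points of $F$ by the canonical identification with $L^2(F,\nu;\mathcal H)$. Write $\|\cdot\|_{\mathcal S_2}$ for the Hilbert–Schmidt norm (with the value $\infty$ if the operator is not Hilbert–Schmidt) and put $0\cdot\infty=0$. (1) There is a Hilbert–Schmidt operator $T$ on $L^2(F,\nu)\hat\otimes\mathcal H$ such that for all $f_1\in L^2(F,\nu)$, $f_2\in\mathcal H$ $$(T(f_1\otimes f_2))(\sigma)=\int_F g(x,\sigma)\,f_1(x)\,S_xf_2\,d\nu(x)\quad\text{for almost all }\sigma\in F,$$ where the integral converges absolutely for almost all $\sigma$, if and only if $$\int_F\int_F|g(x,\sigma)|^2\,d\nu(\sigma)\,\|S_x\|_{\mathcal S_2}^2\,d\nu(x)<\infty .$$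 Let $T$ be a Hilbert–Schmidt operator given by this formula. Then: (2) $\displaystyle \|T\|_{\mathcal S_2}^2=\int_F\int_F|g(x,\sigma)|^2\,d\nu(\sigma)\,\|S_x\|_{\mathcal S_2}^2\,d\nu(x).$ (3) For all $n\ge2$ the operator $T^n$ is trace class and, with $x_{n+1}:=x_1$, $$\operatorname{trace}T^n=\int_{F^n}\Big(\prod_{j=1}^{n}g(x_j,x_{j+1})\Big)\operatorname{trace}(S_{x_n}\circ\cdots\circ S_{x_1})\,d\nu^n(x_1,\dots,x_n).$$ Here $S_{x_n}\circ\cdots\circ S_{x_1}$ is trace class for $\nu^n$-almost all $(x_1,\dots,x_n)$ with $\prod_{j=1}^{n}g(x_j,x_{j+1})\neq0$, the integrand is understood to be $0$ where this product vanishes, and it is integrable. (4) For all $n\ge2$ the operator $T^n$ is Hilbert–Schmidt, and for every orthonormal basis $(h_i)_i$ of $\mathcal H$ $$\|T^n\|_{\mathcal S_2}^2=\int_F\int_F\ \sum_i\ \Big\|\int_{F^{n-1}}\Big(\prod_{j=1}^{n-1}g(x_j,x_{j+1})\Big)g(x_n,\sigma)\,S_{x_n}\circ\cdots\circ S_{x_1}h_i\,d\nu^{n-1}(x_2,\dots,x_n)\Big\|^2\,d\nu(x_1)\,d\nu(\sigma),$$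 where for each $i$ the inner integral converges absolutely for almost all $(x_1,\sigma)$. -/

import Mathlib

open MeasureTheory
open scoped ENNReal TensorProduct InnerProductSpace

noncomputable section

namespace KernelTrace

/-! ### Hilbert--Schmidt norm, trace class operators and trace -/

section Schatten

universe u

variable (E : Type u) [NormedAddCommGroup E] [InnerProductSpace ℂ E] [CompleteSpace E]

/-- The index type of a fixed orthonormal (Hilbert) basis of `E`. -/
def BasisIndex : Type u := ↥(exists_hilbertBasis ℂ E).choose

/-- A fixed orthonormal (Hilbert) basis of `E`. -/
def stdBasis : HilbertBasis (BasisIndex E) ℂ E := (exists_hilbertBasis ℂ E).choose_spec.choose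

variable {E}

/-- The square `∑ᵢ ‖A eᵢ‖²` of the Hilbert--Schmidt norm of a bounded operator, as an extended
nonnegative number. It does not depend on the orthonormal basis, see `hsNormSq_eq_tsum`. -/
def hsNormSq (A : E →L[ℂ] E) : ℝ≥0∞ := ∑' i, ‖A (stdBasis E i)‖ₑ ^ 2

/-- `A` is a Hilbert--Schmidt operator. -/
def IsHilbertSchmidt (A : E →L[ℂ] E) : Prop := hsNormSq A < ∞

/-- The trace norm `∑ᵢ ⟨eᵢ, |A| eᵢ⟩` with `|A| = √(A* A)`. -/
def traceNorm (A : E →L[ℂ] E) : ℝ≥0∞ :=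
  ∑' i, ENNReal.ofReal (RCLike.re ⟪stdBasis E i, CFC.abs A (stdBasis E i)⟫_ℂ)

/-- `A` is a trace class operator. -/
def IsTraceClass (A : E →L[ℂ] E) : Prop := traceNorm A < ∞

/-- The trace `∑ᵢ ⟨eᵢ, A eᵢ⟩` of a trace class operator
(Mathlib's inner product is linear in the second variable). -/
def opTrace (A : E →L[ℂ] E) : ℂ := ∑' i, ⟪stdBasis E i, A (stdBasis E i)⟫_ℂ

/-- Parseval's identity. -/
theorem tsum_enorm_inner_sq {ι : Type*} (b : HilbertBasis ι ℂ E) (x : E) :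
    ∑' i, ‖⟪b i, x⟫_ℂ‖ₑ ^ 2 = ‖x‖ₑ ^ 2 := by
  have h := (b.hasSum_inner_mul_inner x x)
  have h2 : HasSum (fun i => ‖⟪b i, x⟫_ℂ‖ ^ 2) (‖x‖ ^ 2) := by
    have h3 := Complex.hasSum_re h
    simp only [← Complex.ofReal_pow, inner_self_eq_norm_sq_to_K, Complex.coe_algebraMap,
      Complex.ofReal_re] at h3
    convert h3 using 1
    ext i
    rw [← inner_conj_symm x (b i), ← Complex.normSq_eq_conj_mul_self, Complex.ofReal_re,
      Complex.normSq_eq_norm_sq]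
  have h4 : ∀ y : ℂ, ‖y‖ₑ ^ 2 = ENNReal.ofReal (‖y‖ ^ 2) := fun y => by
    rw [ENNReal.ofReal_pow (norm_nonneg _), ofReal_norm]
  simp only [h4]
  rw [← ENNReal.ofReal_tsum_of_nonneg (fun _ => by positivity) h2.summable, h2.tsum_eq,
    ENNReal.ofReal_pow (norm_nonneg _), ofReal_norm]

theorem tsum_enorm_sq_eq_adjoint {κ κ' : Type*} (c : HilbertBasis κ ℂ E) (d : HilbertBasis κ' ℂ E)
    (A : E →L[ℂ] E) :
    ∑' i, ‖A (c i)‖ₑ ^ 2 = ∑' j, ‖ContinuousLinearMap.adjoint A (d j)‖ₑ ^ 2 := by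
  have h1 : ∀ i, ‖A (c i)‖ₑ ^ 2 = ∑' j, ‖⟪d j, A (c i)⟫_ℂ‖ₑ ^ 2 :=
    fun i => (tsum_enorm_inner_sq d _).symm
  have h2 : ∀ j, ‖ContinuousLinearMap.adjoint A (d j)‖ₑ ^ 2 =
      ∑' i, ‖⟪c i, ContinuousLinearMap.adjoint A (d j)⟫_ℂ‖ₑ ^ 2 :=
    fun j => (tsum_enorm_inner_sq c _).symm
  simp only [h1, h2]
  rw [ENNReal.tsum_comm]
  refine tsum_congr fun j => tsum_congr fun i => ?_
  rw [ContinuousLinearMap.adjoint_inner_right, ← inner_conj_symm, ← ofReal_norm, ← ofReal_norm,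
    RCLike.norm_conj]

/-- The Hilbert--Schmidt norm can be computed in every orthonormal basis. -/
theorem hsNormSq_eq_tsum {ι : Type*} (b : HilbertBasis ι ℂ E) (A : E →L[ℂ] E) :
    hsNormSq A = ∑' i, ‖A (b i)‖ₑ ^ 2 := by
  rw [hsNormSq, tsum_enorm_sq_eq_adjoint (stdBasis E) (stdBasis E),
    tsum_enorm_sq_eq_adjoint b (stdBasis E)]

end Schatten

/-! ### The Hilbert space tensor product of `L²(F, ν)` and `H` -/

section Tensor

variable {F : Type*} [MeasurableSpace F] (ν : Measure F)
variable (H : Type*) [NormedAddCommGroup H] [InnerProductSpace ℂ H] [CompleteSpace H]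

/-- The Hilbert space tensor product of `L²(F, ν)` and `H`: the completion of the algebraic tensor
product with respect to the inner product `⟨f₁ ⊗ f₂, h₁ ⊗ h₂⟩ = ⟨f₁, h₁⟩ ⟨f₂, h₂⟩`. -/
abbrev L2Tensor : Type _ := UniformSpace.Completion (Lp ℂ 2 ν ⊗[ℂ] H)

variable {H}

/-- The elementary tensor `f₁ ⊗ f₂`. -/
def elemTensor (f₁ : Lp ℂ 2 ν) (f₂ : H) : L2Tensor ν H :=
  ((f₁ ⊗ₜ[ℂ] f₂ : Lp ℂ 2 ν ⊗[ℂ] H) : UniformSpace.Completion (Lp ℂ 2 ν ⊗[ℂ] H))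

variable (H)

/-- The linear map from the algebraic tensor product to `L²(F, ν; H)` that sends `f₁ ⊗ f₂` to the
class of `x ↦ f₁ x • f₂`. -/
def algToLp : Lp ℂ 2 ν ⊗[ℂ] H →ₗ[ℂ] Lp H 2 ν :=
  TensorProduct.lift ((ContinuousLinearMap.compLpₗ₂ 2 ν
    ((ContinuousLinearMap.toSpanSingletonCLE (𝕜 := ℂ) (E := H)) : H →L[ℂ] ℂ →L[ℂ] H)).flip)

variable {H}

theorem algToLp_tmul (f₁ : Lp ℂ 2 ν) (f₂ : H) :
    algToLp ν H (f₁ ⊗ₜ f₂) =ᵐ[ν] fun x => f₁ x • f₂ := by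
  have h : algToLp ν H (f₁ ⊗ₜ f₂) = (ContinuousLinearMap.toSpanSingleton ℂ f₂).compLp f₁ := rfl
  rw [h]
  filter_upwards [(ContinuousLinearMap.toSpanSingleton ℂ f₂).coeFn_compLp f₁] with x hx
  rw [hx, ContinuousLinearMap.toSpanSingleton_apply]

theorem inner_algToLp (u v : Lp ℂ 2 ν ⊗[ℂ] H) :
    ⟪algToLp ν H u, algToLp ν H v⟫_ℂ = ⟪u, v⟫_ℂ := by
  induction u with
  | zero => simp
  | add a b ha hb => simp only [map_add, inner_add_left, ha, hb]
  | tmul a x =>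
    induction v with
    | zero => simp
    | add a b ha hb => simp only [map_add, inner_add_right, ha, hb]
    | tmul b y =>
      rw [TensorProduct.inner_tmul, L2.inner_def, L2.inner_def, ← integral_mul_const]
      refine integral_congr_ae ?_
      filter_upwards [algToLp_tmul ν a x, algToLp_tmul ν b y] with t h1 h2
      rw [h1, h2, inner_smul_left, inner_smul_right]
      simp only [RCLike.inner_apply]
      ring

theorem denseRange_algToLp : DenseRange (algToLp ν H) := by
  intro f
  induction f using Lp.induction (by simp : (2 : ℝ≥0∞) ≠ ∞) with
  | @indicatorConst c s hs hμs =>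
    refine subset_closure ⟨(indicatorConstLp 2 hs hμs.ne (1 : ℂ)) ⊗ₜ c, ?_⟩
    rw [Lp.simpleFunc.coe_indicatorConst]
    refine Lp.ext ?_
    filter_upwards [algToLp_tmul ν (indicatorConstLp 2 hs hμs.ne (1 : ℂ)) c,
      indicatorConstLp_coeFn (p := 2) (hs := hs) (hμs := hμs.ne) (c := (1 : ℂ)),
      indicatorConstLp_coeFn (p := 2) (hs := hs) (hμs := hμs.ne) (c := c)] with x h1 h2 h3
    rw [h1, h2, h3]
    by_cases hx : x ∈ s <;> simp [Set.indicator, hx]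
  | add hf hg _ h1 h2 =>
    have hr : Set.range (algToLp ν H) = ((LinearMap.range (algToLp ν H)) : Set (Lp H 2 ν)) :=
      (LinearMap.coe_range _).symm
    rw [hr, ← Submodule.topologicalClosure_coe] at h1 h2 ⊢
    exact Submodule.add_mem _ h1 h2
  | isClosed => exact isClosed_closure

variable (H)

/-- The canonical unitary identification of the Hilbert space tensor product of `L²(F, ν)` and `H`
with `L²(F, ν; H)`, through which elements of the tensor product are evaluated at points of `F`. -/
def evalEquiv : L2Tensor ν H ≃ₗᵢ[ℂ] Lp H 2 ν :=
  (LinearEquiv.refl ℂ (Lp ℂ 2 ν ⊗[ℂ] H)).extendOfIsometry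
    (UniformSpace.Completion.toComplₗᵢ (𝕜 := ℂ) (E := Lp ℂ 2 ν ⊗[ℂ] H)).toLinearMap
    (algToLp ν H) UniformSpace.Completion.denseRange_coe (denseRange_algToLp ν)
    (fun x => by
      simpa using ((algToLp ν H).isometryOfInner (inner_algToLp ν)).norm_map x)

variable {H}

theorem evalEquiv_elemTensor (f₁ : Lp ℂ 2 ν) (f₂ : H) :
    evalEquiv ν H (elemTensor ν f₁ f₂) =ᵐ[ν] fun x => f₁ x • f₂ := by
  have h : evalEquiv ν H (elemTensor ν f₁ f₂) = algToLp ν H (f₁ ⊗ₜ f₂) :=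
    LinearEquiv.extendOfIsometry_eq (LinearEquiv.refl ℂ (Lp ℂ 2 ν ⊗[ℂ] H))
      (UniformSpace.Completion.toComplₗᵢ (𝕜 := ℂ) (E := Lp ℂ 2 ν ⊗[ℂ] H)).toLinearMap
      (algToLp ν H) _ _ _ (f₁ ⊗ₜ f₂)
  rw [h]
  exact algToLp_tmul ν f₁ f₂

end Tensor

/-! ### The operators of the lemma -/

section Operators

variable {F : Type*} [MeasurableSpace F] (ν : Measure F)
variable {H : Type*} [NormedAddCommGroup H] [InnerProductSpace ℂ H] [CompleteSpace H]

/-- The family `(S x)` of bounded operators is (weakly) measurable. -/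
def MeasurableFamily (S : F → H →L[ℂ] H) : Prop :=
  ∀ u v : H, Measurable fun x => ⟪u, S x v⟫_ℂ

/-- The bounded operator `T` is given by
`(T (f₁ ⊗ f₂)) σ = ∫ g (x, σ) f₁ x S x f₂ dν(x)`, the integral being
absolutely convergent for almost all `σ`. -/
def IsGivenBy (g : F × F → ℂ) (S : F → H →L[ℂ] H) (T : L2Tensor ν H →L[ℂ] L2Tensor ν H) : Prop :=
  ∀ (f₁ : Lp ℂ 2 ν) (f₂ : H), ∀ᵐ σ ∂ν,
    Integrable (fun x => (g (x, σ) * f₁ x) • S x f₂) ν ∧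
    evalEquiv ν H (T (elemTensor ν f₁ f₂)) σ = ∫ x, (g (x, σ) * f₁ x) • S x f₂ ∂ν

/-- `∫ (∫ |g (x, σ)|² dν(σ)) ‖S x‖² dν(x)` with the Hilbert--Schmidt norm of `S x`, as an extended
nonnegative number (with `0 * ∞ = 0`). -/
def kernelIntegral (g : F × F → ℂ) (S : F → H →L[ℂ] H) : ℝ≥0∞ :=
  ∫⁻ x, (∫⁻ σ, ‖g (x, σ)‖ₑ ^ 2 ∂ν) * hsNormSq (S x) ∂ν

/-- The composition `S xₙ ∘ ⋯ ∘ S x₁`. -/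
def opProd {n : ℕ} (S : F → H →L[ℂ] H) (x : Fin n → F) : H →L[ℂ] H :=
  (List.ofFn fun j => S (x j)).reverse.prod

/-- The cyclic product `g (x₁, x₂) ⋯ g (xₙ₋₁, xₙ) g (xₙ, x₁)`. -/
def cyclicWeight {n : ℕ} (g : F × F → ℂ) (x : Fin n → F) : ℂ :=
  ∏ j, g (x j, x (finRotate n j))

/-- The product `g (x₁, x₂) ⋯ g (xₙ₋₁, xₙ) g (xₙ, σ)`. -/
def pathWeight {n : ℕ} (g : F × F → ℂ) (x : Fin n → F) (σ : F) : ℂ :=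
  ∏ j : Fin n, g (x j, (Fin.snoc x σ : Fin (n + 1) → F) j.succ)

/-- The integrand `g (x, y₁) g (y₁, y₂) ⋯ g (yₘ, σ) S yₘ ⋯ S y₁ S x h` of the integral
over `y` that is the kernel of `T ^ (m + 1)`, applied to `h`. -/
def powKernelIntegrand {m : ℕ} (g : F × F → ℂ) (S : F → H →L[ℂ] H) (x σ : F) (h : H)
    (y : Fin m → F) : H :=
  pathWeight g (Fin.cons x y : Fin (m + 1) → F) σ • opProd S (Fin.cons x y : Fin (m + 1) → F) h

end Operators

end KernelTrace

end

noncomputable section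

namespace KernelTrace

/-! ### Hilbert--Schmidt operators -/

section HilbertSchmidt

/-! Fix an orthonormal basis `(eᵢ)` of `H`, countable by separability. Coordinates identify the
tensor product with the scalar space L² over `F × ι`, where `ι` carries counting measure
(`tensorEquiv`). There Hilbert–Schmidt operators are exactly the integral operators with square
integrable kernels, and the squared Hilbert–Schmidt norm is the squared L² norm of the kernel
(`exists_hasSum_box`, `exists_operator`).

The operator of the lemma has the kernel `g (x, σ) ⟨eⱼ, S x eᵢ⟩`. Its squared L² norm, summed over
`i` and `j`, is `kernelIntegral` (`lintegral_columns`), so (1) and (2) follow once the formula on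
elementary tensors is matched with the kernel. `isGivenBy_of_isKernel` does this in one direction.
In the other, `isKernel_of_isGivenBy`, a Hilbert–Schmidt operator already has some kernel, and
testing on elementary tensors determines its entries.

Composing operators composes kernels (`IsKernel.mul`), and the sums over intermediate basis indices
collapse by Parseval, so powers have kernels given by integrals over paths in `F` (`isKernel_pow`).
The L² norm of such a kernel is (4). For (3), a product of two Hilbert–Schmidt operators is trace
class (`sq_traceNorm_mul_le`), and its trace is the integral of one kernel against the transpose of
the other (`IsKernel.hasSum_inner_mul`). Expanding both kernels gives the integral over closed
paths.

Every interchange of integrals and sums along paths is controlled by the scalar kernel `|g (x, σ)|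
‖S x‖₂` (`hsKernel`), which is square integrable exactly when `kernelIntegral` is finite.
Cauchy–Schwarz bounds its iterates and the closed-path integrals. -/

/-- The Cauchy--Schwarz inequality for extended nonnegative functions. -/
theorem sq_lintegral_mul_le {α : Type*} [MeasurableSpace α] (μ : Measure α) {f g : α → ℝ≥0∞}
    (hf : AEMeasurable f μ) (hg : AEMeasurable g μ) :
    (∫⁻ a, f a * g a ∂μ) ^ 2 ≤ (∫⁻ a, f a ^ 2 ∂μ) * ∫⁻ a, g a ^ 2 ∂μ := by
  have h := ENNReal.lintegral_mul_le_Lp_mul_Lq μ Real.HolderConjugate.two_two hf hg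
  have h2 := pow_le_pow_left' h 2
  simp only [Pi.mul_apply] at h2
  refine h2.trans_eq ?_
  rw [mul_pow, ← ENNReal.rpow_natCast, ← ENNReal.rpow_natCast, ← ENNReal.rpow_mul,
    ← ENNReal.rpow_mul]
  norm_num

/-- The Cauchy--Schwarz inequality for extended nonnegative families. -/
theorem sq_tsum_mul_le {ι : Type*} (f g : ι → ℝ≥0∞) :
    (∑' i, f i * g i) ^ 2 ≤ (∑' i, f i ^ 2) * ∑' i, g i ^ 2 := by
  let _ : MeasurableSpace ι := ⊤
  have h := sq_lintegral_mul_le (Measure.count : Measure ι) (f := f) (g := g)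
    measurable_from_top.aemeasurable measurable_from_top.aemeasurable
  simpa only [lintegral_count] using h

theorem sq_sum_mul_le {ι : Type*} (s : Finset ι) (f g : ι → ℝ≥0∞) :
    (∑ i ∈ s, f i * g i) ^ 2 ≤ (∑' i, f i ^ 2) * ∑' i, g i ^ 2 :=
  (pow_le_pow_left' (ENNReal.sum_le_tsum s) 2).trans (sq_tsum_mul_le f g)

theorem enorm_inner_le {E : Type*} [NormedAddCommGroup E] [InnerProductSpace ℂ E] (x y : E) :
    ‖⟪x, y⟫_ℂ‖ₑ ≤ ‖x‖ₑ * ‖y‖ₑ := by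
  rw [← ofReal_norm, ← ofReal_norm, ← ofReal_norm, ← ENNReal.ofReal_mul (norm_nonneg _)]
  exact ENNReal.ofReal_le_ofReal (norm_inner_le_norm x y)

universe u

variable {E : Type u} [NormedAddCommGroup E] [InnerProductSpace ℂ E] [CompleteSpace E]

theorem hsNormSq_adjoint (A : E →L[ℂ] E) :
    hsNormSq (ContinuousLinearMap.adjoint A) = hsNormSq A := by
  rw [hsNormSq, hsNormSq, tsum_enorm_sq_eq_adjoint (stdBasis E) (stdBasis E) A]

/-- Parseval for `A x`: each coordinate `⟨eᵢ, A x⟩ = ⟨A* eᵢ, x⟩` is at most `‖A* eᵢ‖ ‖x‖`, and `A*`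
has the same Hilbert–Schmidt norm as `A`. -/
theorem enorm_apply_sq_le (A : E →L[ℂ] E) (x : E) : ‖A x‖ₑ ^ 2 ≤ hsNormSq A * ‖x‖ₑ ^ 2 := by
  rw [← hsNormSq_adjoint, ← tsum_enorm_inner_sq (stdBasis E) (A x), hsNormSq,
    ← ENNReal.tsum_mul_right]
  refine ENNReal.tsum_le_tsum fun i => ?_
  rw [← ContinuousLinearMap.adjoint_inner_left, ← mul_pow]
  exact pow_le_pow_left' (enorm_inner_le _ _) 2

theorem hsNormSq_mul_le (A B : E →L[ℂ] E) : hsNormSq (A * B) ≤ hsNormSq A * hsNormSq B := by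
  rw [hsNormSq.eq_def (A * B), hsNormSq.eq_def B, ← ENNReal.tsum_mul_left]
  exact ENNReal.tsum_le_tsum fun i => enorm_apply_sq_le A _

theorem hsNormSq_mul_le_of_contraction (U : E →L[ℂ] E) (hU : ∀ x, ‖U x‖ ≤ ‖x‖)
    (B : E →L[ℂ] E) : hsNormSq (U * B) ≤ hsNormSq B := by
  refine ENNReal.tsum_le_tsum fun i => pow_le_pow_left' ?_ 2
  rw [← ofReal_norm, ← ofReal_norm]
  exact ENNReal.ofReal_le_ofReal (hU _)

theorem IsHilbertSchmidt.pow {A : E →L[ℂ] E} (h : IsHilbertSchmidt A) (n : ℕ) :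
    IsHilbertSchmidt (A ^ (n + 1)) := by
  induction n with
  | zero => simpa using h
  | succ n ih =>
    rw [pow_succ]
    exact (hsNormSq_mul_le _ _).trans_lt (ENNReal.mul_lt_top ih h)

/-- Cauchy–Schwarz for the two matrices as elements of ℓ²(ι × ι). It makes the double expansion of
the trace of `C * D` absolutely convergent. -/
theorem sq_tsum_prod_inner_le {ι : Type*} (b : HilbertBasis ι ℂ E) (C D : E →L[ℂ] E) :
    (∑' p : ι × ι, ‖⟪b p.1, C (b p.2)⟫_ℂ‖ₑ * ‖⟪b p.2, D (b p.1)⟫_ℂ‖ₑ) ^ 2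
      ≤ hsNormSq C * hsNormSq D := by
  refine (sq_tsum_mul_le _ _).trans_eq ?_
  congr 1
  · rw [ENNReal.tsum_prod (f := fun i j => ‖⟪b i, C (b j)⟫_ℂ‖ₑ ^ 2), ENNReal.tsum_comm,
      hsNormSq_eq_tsum b]
    exact tsum_congr fun j => tsum_enorm_inner_sq b _
  · rw [ENNReal.tsum_prod (f := fun i j => ‖⟪b j, D (b i)⟫_ℂ‖ₑ ^ 2), hsNormSq_eq_tsum b]
    exact tsum_congr fun j => tsum_enorm_inner_sq b _

/-- A quantitative approximate polar decomposition. -/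
theorem exists_approx_polar (A : E →L[ℂ] E) {ε : ℝ} (hε : 0 < ε) :
    ∃ U : E →L[ℂ] E, (∀ x, ‖U x‖ ≤ ‖x‖) ∧
      ∀ x, ‖⟪x, CFC.abs A x⟫_ℂ - ⟪U x, A x⟫_ℂ‖ ≤ ε * ‖x‖ ^ 2 := by
  set P := CFC.abs A with hP
  have hP0 : 0 ≤ P := CFC.abs_nonneg A
  have hpos : P.IsPositive := (ContinuousLinearMap.nonneg_iff_isPositive P).1 hP0
  have hsq : P * P = ContinuousLinearMap.adjoint A * A := CFC.abs_mul_abs A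
  have hsym : ∀ x y, ⟪P x, y⟫_ℂ = ⟪x, P y⟫_ℂ := fun x y => hpos.isSymmetric x y
  have hAP : ∀ x y, ⟪A x, A y⟫_ℂ = ⟪P x, P y⟫_ℂ := fun x y => by
    rw [hsym, ← mul_apply_eq_comp, hsq, mul_apply_eq_comp,
      ContinuousLinearMap.adjoint_inner_right]
  have hnorm : ∀ x, ‖A x‖ = ‖P x‖ := fun x => by
    rw [@norm_eq_sqrt_re_inner ℂ, @norm_eq_sqrt_re_inner ℂ, hAP]
  -- The spectrum of `P ≥ 0` avoids `-ε`, so `P + ε` is invertible. Its inverse is `R` below; the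
  -- sign there comes from `V = -ε - P`.
  have hunit : IsUnit (algebraMap ℝ (E →L[ℂ] E) (-ε) - P) := by
    rw [← spectrum.notMem_iff]
    intro h
    have := spectrum_nonneg_of_nonneg hP0 h
    linarith
  obtain ⟨V, hV⟩ := hunit
  set R : E →L[ℂ] E := -(V⁻¹ : (E →L[ℂ] E)ˣ) with hR
  have hR1 : ∀ x, P (R x) + (ε : ℂ) • R x = x := fun x => by
    have h1 : (V : E →L[ℂ] E) * ((V⁻¹ : (E →L[ℂ] E)ˣ) : E →L[ℂ] E) = 1 := V.mul_inv
    have h2 := congrArg (fun B : E →L[ℂ] E => B x) h1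
    simp only [hV, mul_apply_eq_comp, sub_apply,
      one_apply_eq_self] at h2
    rw [Algebra.algebraMap_eq_smul_one] at h2
    simp only [smul_apply, one_apply_eq_self] at h2
    simp only [hR, neg_apply, map_neg, Complex.coe_smul]
    refine Eq.trans ?_ h2
    rw [neg_smul, smul_neg]
    abel
  -- Expand the square of `‖x‖ = ‖P R x + ε R x‖`; the cross term is nonnegative because `P` is.
  have hPR : ∀ x, ‖P (R x)‖ ≤ ‖x‖ := fun x => by
    have h1 : ‖P (R x) + (ε : ℂ) • R x‖ ^ 2 = ‖P (R x)‖ ^ 2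
        + 2 * RCLike.re ⟪P (R x), (ε : ℂ) • R x⟫_ℂ + ‖(ε : ℂ) • R x‖ ^ 2 :=
      @norm_add_sq ℂ _ _ _ _ _ _
    rw [hR1] at h1
    have h2 : 0 ≤ RCLike.re ⟪P (R x), (ε : ℂ) • R x⟫_ℂ := by
      rw [inner_smul_right]
      have := hpos.re_inner_nonneg_left (R x)
      simp only [RCLike.re_to_complex, Complex.re_ofReal_mul] at this ⊢
      positivity
    nlinarith [norm_nonneg (P (R x)), norm_nonneg x, sq_nonneg ‖(ε : ℂ) • R x‖]
  -- `U = A (|A| + ε)⁻¹` regularises the partial isometry of the polar decomposition. Since `A* A =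
  -- P²` and `x - P R x = ε R x`, the error is exactly `ε ⟨P R x, x⟩`.
  refine ⟨A * R, fun x => ?_, fun x => ?_⟩
  · rw [mul_apply_eq_comp, hnorm]
    exact hPR x
  · have h1 : ⟪x, P x⟫_ℂ - ⟪(A * R) x, A x⟫_ℂ = ⟪(ε : ℂ) • P (R x), x⟫_ℂ := by
      rw [mul_apply_eq_comp, hAP]
      nth_rewrite 1 [← hR1 x]
      rw [inner_add_left, add_sub_cancel_left, inner_smul_left, inner_smul_left, hsym]
    rw [h1]
    refine (norm_inner_le_norm _ _).trans ?_
    rw [norm_smul, Complex.norm_real, Real.norm_of_nonneg hε.le, mul_assoc, sq]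
    gcongr
    exact hPR x

/-- Up to a small error `⟨eᵢ, |CD| eᵢ⟩` is `⟨U eᵢ, C D eᵢ⟩ = ⟨C* U eᵢ, D eᵢ⟩` with a contraction
`U`. Cauchy–Schwarz over finitely many `i` then leaves the Hilbert–Schmidt norms of `C* U` and `D`.
-/
theorem sq_traceNorm_mul_le (C D : E →L[ℂ] E) :
    traceNorm (C * D) ^ 2 ≤ hsNormSq C * hsNormSq D := by
  suffices h : traceNorm (C * D) ≤ (hsNormSq C * hsNormSq D) ^ (1 / 2 : ℝ) by
    refine (pow_le_pow_left' h 2).trans_eq ?_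
    rw [← ENNReal.rpow_natCast, ← ENNReal.rpow_mul]
    norm_num
  rw [traceNorm, ENNReal.tsum_eq_iSup_sum]
  refine iSup_le fun s => ?_
  refine ENNReal.le_of_forall_pos_le_add fun δ hδ _ => ?_
  have hs : (0 : ℝ) < s.card + 1 := by positivity
  -- The errors of the `s.card` terms add up to at most `δ`; the `+ 1` covers an empty `s`.
  obtain ⟨U, hU, hUA⟩ := exists_approx_polar (C * D) (ε := δ / (s.card + 1)) (by positivity)
  have hterm : ∀ i, ENNReal.ofReal (RCLike.re ⟪stdBasis E i, CFC.abs (C * D) (stdBasis E i)⟫_ℂ) ≤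
      ‖(ContinuousLinearMap.adjoint C * U) (stdBasis E i)‖ₑ * ‖D (stdBasis E i)‖ₑ +
          ENNReal.ofReal (δ / (s.card + 1)) := by
    intro i
    have h1 := hUA (stdBasis E i)
    rw [(stdBasis E).orthonormal.norm_eq_one, one_pow, mul_one] at h1
    have h2 : ⟪U (stdBasis E i), (C * D) (stdBasis E i)⟫_ℂ
        = ⟪(ContinuousLinearMap.adjoint C * U) (stdBasis E i), D (stdBasis E i)⟫_ℂ := by
      rw [mul_apply_eq_comp, mul_apply_eq_comp,
        ContinuousLinearMap.adjoint_inner_left]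
    rw [← ofReal_norm, ← ofReal_norm, ← ENNReal.ofReal_mul (norm_nonneg _),
      ← ENNReal.ofReal_add (by positivity) (by positivity)]
    refine ENNReal.ofReal_le_ofReal ?_
    have h3 := norm_inner_le_norm (𝕜 := ℂ)
      ((ContinuousLinearMap.adjoint C * U) (stdBasis E i)) (D (stdBasis E i))
    rw [← h2] at h3
    have h4 := RCLike.re_le_norm ⟪stdBasis E i, CFC.abs (C * D) (stdBasis E i)⟫_ℂ
    have h5 := norm_sub_norm_le ⟪stdBasis E i, CFC.abs (C * D) (stdBasis E i)⟫_ℂ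
      ⟪U (stdBasis E i), (C * D) (stdBasis E i)⟫_ℂ
    linarith
  refine (Finset.sum_le_sum fun i _ => hterm i).trans ?_
  rw [Finset.sum_add_distrib]
  refine add_le_add ?_ ?_
  · have h1 := sq_sum_mul_le s (fun i => ‖(ContinuousLinearMap.adjoint C * U) (stdBasis E i)‖ₑ)
      (fun i => ‖D (stdBasis E i)‖ₑ)
    have h2 : hsNormSq (ContinuousLinearMap.adjoint C * U) ≤ hsNormSq C := by
      -- Taking adjoints moves the contraction to the left, where it shrinks each column.
      rw [← hsNormSq_adjoint (ContinuousLinearMap.adjoint C * U), ← hsNormSq_adjoint C]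
      have h3 : ContinuousLinearMap.adjoint (ContinuousLinearMap.adjoint C * U) =
          ContinuousLinearMap.adjoint U * C := by
        change star (star C * U) = star U * C
        rw [star_mul, star_star]
      rw [h3, hsNormSq_adjoint]
      refine hsNormSq_mul_le_of_contraction _ (fun x => ?_) _
      refine (ContinuousLinearMap.le_opNorm _ _).trans ?_
      have h4 : ‖ContinuousLinearMap.adjoint U‖ ≤ 1 := by
        rw [LinearIsometryEquiv.norm_map]
        exact U.opNorm_le_bound zero_le_one fun x => by simpa using hU x
      exact mul_le_of_le_one_left (norm_nonneg _) h4
    have h3 := h1.trans (mul_le_mul_left h2 (hsNormSq D))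
    have h4 := ENNReal.rpow_le_rpow h3 (by norm_num : (0 : ℝ) ≤ 1 / 2)
    refine le_of_eq_of_le ?_ h4
    rw [← ENNReal.rpow_natCast, ← ENNReal.rpow_mul]
    norm_num
  · rw [Finset.sum_const, nsmul_eq_mul, ← ENNReal.ofReal_natCast,
      ← ENNReal.ofReal_mul (by positivity), ← ENNReal.ofReal_coe_nnreal]
    refine ENNReal.ofReal_le_ofReal ?_
    rw [mul_div_assoc', div_le_iff₀ hs]
    nlinarith [δ.coe_nonneg]

theorem IsHilbertSchmidt.isTraceClass_mul {C D : E →L[ℂ] E} (hC : IsHilbertSchmidt C)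
    (hD : IsHilbertSchmidt D) : IsTraceClass (C * D) := by
  have h := (sq_traceNorm_mul_le C D).trans_lt (ENNReal.mul_lt_top hC hD)
  rw [sq] at h
  by_contra h2
  rw [IsTraceClass, not_lt, top_le_iff] at h2
  simp [h2] at h

end HilbertSchmidt

/-! ### Square integrable functions on products -/

section SquareIntegrable

open scoped ComplexConjugate

variable {X Y G : Type*} [MeasurableSpace X] [MeasurableSpace Y] [NormedAddCommGroup G]

theorem eLpNorm_two_sq (μ : Measure X) (f : X → G) :
    eLpNorm f 2 μ ^ 2 = ∫⁻ x, ‖f x‖ₑ ^ 2 ∂μ := by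
  rw [eLpNorm_eq_lintegral_rpow_enorm_toReal (by norm_num) (by norm_num), ← ENNReal.rpow_natCast,
    ← ENNReal.rpow_mul]
  norm_num

theorem memLp_two_iff {μ : Measure X} {f : X → G} :
    MemLp f 2 μ ↔ AEStronglyMeasurable f μ ∧ ∫⁻ x, ‖f x‖ₑ ^ 2 ∂μ < ∞ := by
  rw [MemLp, ← eLpNorm_two_sq, ENNReal.pow_lt_top_iff]
  simp

theorem lintegral_enorm_sq_Lp {μ : Measure X} (f : Lp G 2 μ) :
    ∫⁻ x, ‖f x‖ₑ ^ 2 ∂μ = ‖f‖ₑ ^ 2 := by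
  rw [Lp.enorm_def, eLpNorm_two_sq]

theorem lintegral_enorm_sq_lt_top {μ : Measure X} (f : Lp G 2 μ) :
    ∫⁻ x, ‖f x‖ₑ ^ 2 ∂μ < ∞ := by
  rw [lintegral_enorm_sq_Lp]
  exact ENNReal.pow_lt_top enorm_lt_top

/-- On a σ-finite measure space there is a bounded positive integrable weight. -/
theorem exists_weight (μ : Measure X) [SigmaFinite μ] :
    ∃ w : X → ℝ, Measurable w ∧ (∀ x, 0 < w x) ∧ (∀ x, w x ≤ 1) ∧ Integrable w μ ∧
      MemLp (fun x => (w x : ℂ)) 2 μ := by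
  obtain ⟨v, hv0, hvm, hv⟩ := exists_pos_lintegral_lt_of_sigmaFinite μ one_ne_zero
  have hm : Measurable fun x => min (v x : ℝ) 1 := by fun_prop
  have h1 : ∀ x, ‖min (v x : ℝ) 1‖ₑ ≤ v x := fun x => by
    rw [Real.enorm_eq_ofReal (le_min (v x).coe_nonneg zero_le_one), ← ENNReal.ofReal_coe_nnreal]
    exact ENNReal.ofReal_le_ofReal (min_le_left _ _)
  have h2 : ∀ x, ‖min (v x : ℝ) 1‖ₑ ≤ 1 := fun x => by
    rw [Real.enorm_eq_ofReal (le_min (v x).coe_nonneg zero_le_one), ← ENNReal.ofReal_one]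
    exact ENNReal.ofReal_le_ofReal (min_le_right _ _)
  refine ⟨fun x => min (v x : ℝ) 1, hm, fun x => lt_min (hv0 x) one_pos, fun x => min_le_right _ _,
    ⟨hm.aestronglyMeasurable, (lintegral_mono h1).trans_lt (hv.trans ENNReal.one_lt_top)⟩,
    memLp_two_iff.2 ⟨by fun_prop, ?_⟩⟩
  refine (lintegral_mono fun x => ?_).trans_lt (hv.trans ENNReal.one_lt_top)
  rw [← ofReal_norm, Complex.norm_real, ofReal_norm, sq]
  exact (mul_le_mul' (h1 x) (h2 x)).trans_eq (mul_one _)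

/-- An integrable function on a product whose integral over every rectangle vanishes is zero. -/
theorem ae_eq_zero_of_forall_setIntegral_rectangle {μ : Measure X} {ν : Measure Y} [SigmaFinite μ]
    [SigmaFinite ν] {ψ : X × Y → ℂ} (hψ : Integrable ψ (μ.prod ν))
    (h : ∀ A B, MeasurableSet A → MeasurableSet B → ∫ p in A ×ˢ B, ψ p ∂μ.prod ν = 0) :
    ψ =ᵐ[μ.prod ν] 0 := by
  refine hψ.ae_eq_zero_of_forall_setIntegral_eq_zero fun s hs hfin => ?_
  -- Finiteness of the measure does not pass to complements, so it is dropped before the π-λ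
  -- induction; integrability of `ψ` on the whole product suffices.
  clear hfin
  induction s, hs using MeasurableSpace.induction_on_inter generateFrom_prod.symm
    isPiSystem_prod with
  | empty => simp
  | basic s hs =>
    obtain ⟨A, hA, B, hB, rfl⟩ := hs
    exact h A B hA hB
  | compl t ht iht =>
    have h1 := integral_add_compl ht hψ
    have h2 := h Set.univ Set.univ .univ .univ
    rw [Set.univ_prod_univ, setIntegral_univ] at h2
    rwa [iht, h2, zero_add] at h1
  | iUnion f hd hm ih =>
    rw [integral_iUnion hm hd hψ.integrableOn]
    simp [ih]

theorem aestronglyMeasurable_box {μ : Measure X} {ν : Measure Y} [SFinite μ] [SFinite ν]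
    {f : X → ℂ} {h : Y → ℂ} (hf : AEStronglyMeasurable f μ) (hh : AEStronglyMeasurable h ν) :
    AEStronglyMeasurable (fun p : X × Y => conj (f p.1) * h p.2) (μ.prod ν) :=
  (Complex.continuous_conj.comp_aestronglyMeasurable hf.comp_fst).mul hh.comp_snd

theorem memLp_box {μ : Measure X} {ν : Measure Y} [SFinite μ] [SFinite ν] {f : X → ℂ} {h : Y → ℂ}
    (hf : MemLp f 2 μ) (hh : MemLp h 2 ν) :
    MemLp (fun p : X × Y => conj (f p.1) * h p.2) 2 (μ.prod ν) := by
  refine memLp_two_iff.2 ⟨aestronglyMeasurable_box hf.1 hh.1, ?_⟩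
  have h1 : ∀ p : X × Y, ‖conj (f p.1) * h p.2‖ₑ ^ 2 = ‖f p.1‖ₑ ^ 2 * ‖h p.2‖ₑ ^ 2 := fun p => by
    rw [enorm_mul, mul_pow, ← ofReal_norm, RCLike.norm_conj, ofReal_norm]
  simp only [h1]
  rw [lintegral_prod_mul (f := fun x => ‖f x‖ₑ ^ 2) (g := fun x => ‖h x‖ₑ ^ 2)
    (hf.1.enorm.pow_const 2) (hh.1.enorm.pow_const 2)]
  exact ENNReal.mul_lt_top (memLp_two_iff.1 hf).2 (memLp_two_iff.1 hh).2

theorem coeFn_ae_fst {μ : Measure X} {β : Type*} {f g : X → β} (h : f =ᵐ[μ] g) :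
    (fun p : X × X => f p.1) =ᵐ[μ.prod μ] fun p => g p.1 :=
  Measure.quasiMeasurePreserving_fst.ae_eq_comp h

theorem coeFn_ae_snd {μ : Measure X} [SFinite μ] {β : Type*} {f g : X → β} (h : f =ᵐ[μ] g) :
    (fun p : X × X => f p.2) =ᵐ[μ.prod μ] fun p => g p.2 :=
  Measure.quasiMeasurePreserving_snd.ae_eq_comp h

variable {μ : Measure X} [SigmaFinite μ]

/-- The function `(x, σ) ↦ conj (f x) * h σ`, the kernel of the operator `u ↦ ⟨f, u⟩ h`. -/
def box (f h : Lp ℂ 2 μ) : Lp ℂ 2 (μ.prod μ) := (memLp_box (Lp.memLp f) (Lp.memLp h)).toLp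

theorem coeFn_box (f h : Lp ℂ 2 μ) :
    box f h =ᵐ[μ.prod μ] fun p => conj (f p.1) * h p.2 := MemLp.coeFn_toLp _

theorem inner_box_left (f h : Lp ℂ 2 μ) (K : Lp ℂ 2 (μ.prod μ)) :
    ⟪box f h, K⟫_ℂ = ∫ p, K p * (f p.1 * conj (h p.2)) ∂μ.prod μ := by
  rw [L2.inner_def]
  refine integral_congr_ae ?_
  filter_upwards [coeFn_box f h] with p hp
  rw [hp, RCLike.inner_apply]
  simp

theorem inner_box_box (f h f' h' : Lp ℂ 2 μ) :
    ⟪box f h, box f' h'⟫_ℂ = ⟪f', f⟫_ℂ * ⟪h, h'⟫_ℂ := by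
  rw [inner_box_left, L2.inner_def, L2.inner_def, ← integral_prod_mul]
  refine integral_congr_ae ?_
  filter_upwards [coeFn_box f' h'] with p hp
  rw [hp, RCLike.inner_apply, RCLike.inner_apply]
  ring

theorem box_add_right (f h h' : Lp ℂ 2 μ) : box f (h + h') = box f h + box f h' := by
  refine Lp.ext ?_
  filter_upwards [coeFn_box f (h + h'), coeFn_box f h, coeFn_box f h',
    Lp.coeFn_add (box f h) (box f h'), coeFn_ae_snd (Lp.coeFn_add h h')] with p h1 h2 h3 h4 h5
  rw [h1, h4, Pi.add_apply, h2, h3, h5, Pi.add_apply, mul_add]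

theorem box_smul_right (f h : Lp ℂ 2 μ) (c : ℂ) : box f (c • h) = c • box f h := by
  refine Lp.ext ?_
  filter_upwards [coeFn_box f (c • h), coeFn_box f h, Lp.coeFn_smul c (box f h),
    coeFn_ae_snd (Lp.coeFn_smul c h)] with p h1 h2 h4 h5
  rw [h1, h4, Pi.smul_apply, h2, h5, Pi.smul_apply, smul_eq_mul, smul_eq_mul]
  ring

theorem box_add_left (f f' h : Lp ℂ 2 μ) : box (f + f') h = box f h + box f' h := by
  refine Lp.ext ?_
  filter_upwards [coeFn_box (f + f') h, coeFn_box f h, coeFn_box f' h,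
    Lp.coeFn_add (box f h) (box f' h), coeFn_ae_fst (Lp.coeFn_add f f')] with p h1 h2 h3 h4 h5
  rw [h1, h4, Pi.add_apply, h2, h3, h5, Pi.add_apply, map_add, add_mul]

theorem box_smul_left (f h : Lp ℂ 2 μ) (c : ℂ) : box (c • f) h = conj c • box f h := by
  refine Lp.ext ?_
  filter_upwards [coeFn_box (c • f) h, coeFn_box f h, Lp.coeFn_smul (conj c) (box f h),
    coeFn_ae_fst (Lp.coeFn_smul c f)] with p h1 h2 h4 h5
  rw [h1, h4, Pi.smul_apply, h2, h5, Pi.smul_apply, smul_eq_mul, smul_eq_mul, map_mul]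
  ring

theorem norm_box (f h : Lp ℂ 2 μ) : ‖box f h‖ = ‖f‖ * ‖h‖ := by
  have h1 := inner_box_box f h f h
  rw [inner_self_eq_norm_sq_to_K, inner_self_eq_norm_sq_to_K, inner_self_eq_norm_sq_to_K] at h1
  norm_cast at h1
  rw [← mul_pow] at h1
  exact (pow_left_inj₀ (norm_nonneg _) (by positivity) two_ne_zero).1 h1

/-- `box f` as an isometry for a unit vector `f`. -/
def boxIsometry (f : Lp ℂ 2 μ) (hf : ‖f‖ = 1) : Lp ℂ 2 μ →ₗᵢ[ℂ] Lp ℂ 2 (μ.prod μ) where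
  toFun := box f
  map_add' := box_add_right f
  map_smul' c h := box_smul_right f h c
  norm_map' h := by
    change ‖box f h‖ = ‖h‖
    rw [norm_box, hf, one_mul]

/-- The functions `box f h` are total. -/
theorem eq_zero_of_forall_inner_box (K : Lp ℂ 2 (μ.prod μ)) (hK : ∀ f h, ⟪box f h, K⟫_ℂ = 0) :
    K = 0 := by
  -- The weight makes every indicator square integrable and `w ⊗ w · K` integrable on the whole
  -- product, so rectangles decide whether it vanishes. Positivity of `w` then removes the weight.
  obtain ⟨w, hwm, hw0, -, -, hw⟩ := exists_weight μ
  have hbox : MemLp (fun p : X × X => conj (w p.1 : ℂ) * (w p.2 : ℂ)) 2 (μ.prod μ) :=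
    memLp_box hw hw
  have h1 : (fun p => (conj (w p.1 : ℂ) * (w p.2 : ℂ)) * K p) =ᵐ[μ.prod μ] 0 := by
    refine ae_eq_zero_of_forall_setIntegral_rectangle (hbox.integrable_mul (Lp.memLp K))
      fun A B hA hB => ?_
    have h2 := hK (hw.indicator hA).toLp (hw.indicator hB).toLp
    rw [inner_box_left] at h2
    rw [← h2, ← integral_indicator (hA.prod hB)]
    refine integral_congr_ae ?_
    filter_upwards [coeFn_ae_fst (hw.indicator hA).coeFn_toLp,
      coeFn_ae_snd (hw.indicator hB).coeFn_toLp] with p h3 h4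
    rw [h3, h4]
    by_cases hpA : p.1 ∈ A <;> by_cases hpB : p.2 ∈ B <;>
      simp [Set.indicator, hpA, hpB, mul_comm]
  refine (Lp.eq_zero_iff_ae_eq_zero).2 ?_
  filter_upwards [h1] with p hp
  have := (hw0 p.1).ne'
  have := (hw0 p.2).ne'
  simpa [*] using hp

end SquareIntegrable

/-! ### Integral operators with square integrable kernels -/

section Kernels

open scoped ComplexConjugate

variable {X : Type*} [MeasurableSpace X] {μ : Measure X} [SigmaFinite μ]

/-- The bounded operator `T` is the integral operator with the square integrable kernel `k`. -/
structure IsKernel (k : X × X → ℂ) (T : Lp ℂ 2 μ →L[ℂ] Lp ℂ 2 μ) : Prop where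
  measurable : Measurable k
  memLp : MemLp k 2 (μ.prod μ)
  inner_eq : ∀ f h, ⟪box f h, memLp.toLp⟫_ℂ = ⟪h, T f⟫_ℂ

/-- A Hilbert--Schmidt operator is represented by a square integrable function. -/
theorem exists_hasSum_box {ι : Type*} (b : HilbertBasis ι ℂ (Lp ℂ 2 μ))
    (T : Lp ℂ 2 μ →L[ℂ] Lp ℂ 2 μ) (hT : IsHilbertSchmidt T) :
    ∃ K : Lp ℂ 2 (μ.prod μ), HasSum (fun i => box (b i) (T (b i))) K ∧
      (∀ f h, ⟪box f h, K⟫_ℂ = ⟪h, T f⟫_ℂ) ∧ ‖K‖ₑ ^ 2 = hsNormSq T := by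
  have hb : ∀ i, ‖b i‖ = 1 := b.orthonormal.norm_eq_one
  -- The terms of the series lie in mutually orthogonal subspaces, so it converges because `∑ ‖T (b
  -- i)‖²` does.
  have hV : OrthogonalFamily ℂ (fun _ : ι => Lp ℂ 2 μ) fun i => boxIsometry (b i) (hb i) := by
    intro i j hij v w
    change ⟪box (b i) v, box (b j) w⟫_ℂ = 0
    rw [inner_box_box, b.orthonormal.inner_eq_zero hij.symm, zero_mul]
  have hE : ∀ i, ‖T (b i)‖ₑ ^ 2 = ENNReal.ofReal (‖T (b i)‖ ^ 2) := fun i => by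
    rw [ENNReal.ofReal_pow (norm_nonneg _), ofReal_norm]
  have hsum : Summable fun i => ‖T (b i)‖ ^ 2 := by
    rw [IsHilbertSchmidt, hsNormSq_eq_tsum b] at hT
    have h1 := ENNReal.summable_toReal hT.ne
    simpa using h1
  have hK : Summable fun i => box (b i) (T (b i)) :=
    (hV.summable_iff_norm_sq_summable fun i => T (b i)).2 hsum
  obtain ⟨K, hK⟩ := hK
  have hin : ∀ f h, ⟪box f h, K⟫_ℂ = ⟪h, T f⟫_ℂ := fun f h => by
    have h1 : HasSum (fun i => ⟪box f h, box (b i) (T (b i))⟫_ℂ) ⟪box f h, K⟫_ℂ :=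
      (innerSL ℂ (box f h)).hasSum hK
    have h2 : HasSum (fun i => ⟪h, T (b.repr f i • b i)⟫_ℂ) ⟪h, T f⟫_ℂ :=
      (innerSL ℂ h).hasSum (T.hasSum (b.hasSum_repr f))
    refine h1.unique ?_
    convert h2 using 2 with i
    rw [map_smul, inner_smul_right, inner_box_box, b.repr_apply_apply]
  refine ⟨K, hK, hin, ?_⟩
  have h1 : HasSum (fun i => ⟪K, box (b i) (T (b i))⟫_ℂ) ⟪K, K⟫_ℂ := (innerSL ℂ K).hasSum hK
  have h2 : ∀ i, ⟪K, box (b i) (T (b i))⟫_ℂ = ((‖T (b i)‖ ^ 2 : ℝ) : ℂ) := fun i => by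
    rw [← inner_conj_symm, hin, inner_self_eq_norm_sq_to_K]
    simp
  rw [inner_self_eq_norm_sq_to_K] at h1
  simp only [h2] at h1
  replace h1 := Complex.hasSum_re h1
  simp only [Complex.ofReal_re, Complex.coe_algebraMap, ← Complex.ofReal_pow] at h1
  rw [hsNormSq_eq_tsum b]
  simp only [hE]
  rw [← ENNReal.ofReal_tsum_of_nonneg (fun _ => by positivity) h1.summable, h1.tsum_eq,
    ENNReal.ofReal_pow (norm_nonneg _), ofReal_norm]

/-- Every square integrable function represents a Hilbert--Schmidt operator. -/
theorem exists_operator (K : Lp ℂ 2 (μ.prod μ)) :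
    ∃ T : Lp ℂ 2 μ →L[ℂ] Lp ℂ 2 μ, IsHilbertSchmidt T ∧ ∀ f h, ⟪box f h, K⟫_ℂ = ⟪h, T f⟫_ℂ := by
  -- Since `box` is conjugate linear in its first argument, this form is sesquilinear and bounded by
  -- `‖K‖`; Riesz representation yields the operator.
  let B : Lp ℂ 2 μ →L⋆[ℂ] Lp ℂ 2 μ →L[ℂ] ℂ :=
    LinearMap.mkContinuous₂ (LinearMap.mk₂'ₛₗ (starRingEnd ℂ) (RingHom.id ℂ)
      (fun f h => ⟪K, box f h⟫_ℂ)
      (fun f f' h => by rw [box_add_left, inner_add_right])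
      (fun c f h => by rw [box_smul_left, inner_smul_right]; rfl)
      (fun f h h' => by rw [box_add_right, inner_add_right])
      (fun c f h => by rw [box_smul_right, inner_smul_right]; rfl)) ‖K‖
      (fun f h => by
        refine (norm_inner_le_norm K (box f h)).trans_eq ?_
        rw [norm_box, mul_assoc])
  have hT : ∀ f h, ⟪box f h, K⟫_ℂ = ⟪h, InnerProductSpace.continuousLinearMapOfBilin B f⟫_ℂ :=
    fun f h => by
      rw [← inner_conj_symm, ← inner_conj_symm h]
      congr 1
      exact (InnerProductSpace.continuousLinearMapOfBilin_apply B f h).symm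
  refine ⟨InnerProductSpace.continuousLinearMapOfBilin B, ?_, hT⟩
  set T := InnerProductSpace.continuousLinearMapOfBilin B
  set b := stdBasis (Lp ℂ 2 μ)
  suffices h : hsNormSq T ≤ ENNReal.ofReal (‖K‖ ^ 2) from h.trans_lt ENNReal.ofReal_lt_top
  rw [hsNormSq, ENNReal.tsum_eq_iSup_sum]
  refine iSup_le fun s => ?_
  have hE : ∀ i, ‖T (b i)‖ₑ ^ 2 = ENNReal.ofReal (‖T (b i)‖ ^ 2) := fun i => by
    rw [ENNReal.ofReal_pow (norm_nonneg _), ofReal_norm]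
  simp only [hE, b]
  rw [← ENNReal.ofReal_sum_of_nonneg fun _ _ => by positivity]
  refine ENNReal.ofReal_le_ofReal ?_
  -- Bessel's inequality: `⟨P, K⟩ = ⟨P, P⟩` forces `‖P‖ ≤ ‖K‖`, uniformly in `s`.
  set P := ∑ i ∈ s, box (b i) (T (b i))
  have h1 : ⟪P, K⟫_ℂ = ((∑ i ∈ s, ‖T (b i)‖ ^ 2 : ℝ) : ℂ) := by
    rw [sum_inner, Complex.ofReal_sum]
    refine Finset.sum_congr rfl fun i _ => ?_
    rw [hT, inner_self_eq_norm_sq_to_K]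
    simp
  have h2 : ⟪P, P⟫_ℂ = ((∑ i ∈ s, ‖T (b i)‖ ^ 2 : ℝ) : ℂ) := by
    rw [sum_inner, Complex.ofReal_sum]
    refine Finset.sum_congr rfl fun i hi => ?_
    rw [inner_sum, Finset.sum_eq_single_of_mem i hi]
    · rw [inner_box_box, inner_self_eq_norm_sq_to_K, b.orthonormal.norm_eq_one,
        inner_self_eq_norm_sq_to_K]
      simp
    · intro j _ hji
      rw [inner_box_box, b.orthonormal.inner_eq_zero hji, zero_mul]
  have h3 : ‖P‖ ^ 2 = ∑ i ∈ s, ‖T (b i)‖ ^ 2 := by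
    rw [← @inner_self_eq_norm_sq ℂ, h2, RCLike.re_to_complex, Complex.ofReal_re]
  have h4 := norm_inner_le_norm (𝕜 := ℂ) P K
  rw [h1, ← h3, Complex.norm_real, Real.norm_of_nonneg (by positivity)] at h4
  rw [← h3]
  have h5 : ‖P‖ ≤ ‖K‖ := by
    by_contra h
    push Not at h
    nlinarith [norm_nonneg P, norm_nonneg K]
  gcongr

theorem exists_isKernel {k : X × X → ℂ} (hk : Measurable k) (hk2 : MemLp k 2 (μ.prod μ)) :
    ∃ T : Lp ℂ 2 μ →L[ℂ] Lp ℂ 2 μ, IsHilbertSchmidt T ∧ IsKernel k T := by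
  obtain ⟨T, hT, h⟩ := exists_operator hk2.toLp
  exact ⟨T, hT, hk, hk2, h⟩

theorem IsHilbertSchmidt.exists_isKernel {T : Lp ℂ 2 μ →L[ℂ] Lp ℂ 2 μ} (hT : IsHilbertSchmidt T) :
    ∃ k, IsKernel k T := by
  obtain ⟨K, -, hK, -⟩ := exists_hasSum_box (stdBasis _) T hT
  exact ⟨K, (Lp.stronglyMeasurable K).measurable, Lp.memLp K, by simpa using hK⟩

namespace IsKernel

variable {k l : X × X → ℂ} {T C D : Lp ℂ 2 μ →L[ℂ] Lp ℂ 2 μ}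

theorem congr (hk : IsKernel k T) (hl : Measurable l) (h : k =ᵐ[μ.prod μ] l) : IsKernel l T := by
  have h2 := (memLp_congr_ae h).1 hk.memLp
  refine ⟨hl, h2, ?_⟩
  rw [← (MemLp.toLp_eq_toLp_iff hk.memLp h2).2 h]
  exact hk.inner_eq

theorem toLp_eq (hk : IsKernel k T) {K : Lp ℂ 2 (μ.prod μ)}
    (hK : ∀ f h, ⟪box f h, K⟫_ℂ = ⟪h, T f⟫_ℂ) : K = hk.memLp.toLp := by
  rw [← sub_eq_zero]
  refine eq_zero_of_forall_inner_box _ fun f h => ?_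
  rw [inner_sub_right, hK, hk.inner_eq, sub_self]

theorem hasSum_box (hk : IsKernel k T) (hT : IsHilbertSchmidt T) {ι : Type*}
    (b : HilbertBasis ι ℂ (Lp ℂ 2 μ)) :
    HasSum (fun i => box (b i) (T (b i))) hk.memLp.toLp := by
  obtain ⟨K, hK, hin, -⟩ := exists_hasSum_box b T hT
  rwa [← hk.toLp_eq hin]

/-- The kernel determines all matrix coefficients of `T`, hence `T` is the Hilbert–Schmidt operator
built from that kernel. -/
theorem isHilbertSchmidt (hk : IsKernel k T) : IsHilbertSchmidt T := by
  obtain ⟨T', hT', h⟩ := exists_operator hk.memLp.toLp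
  have : T' = T := by
    ext1 f
    refine ext_inner_left ℂ fun h' => ?_
    rw [← h, hk.inner_eq]
  rwa [← this]

theorem hsNormSq_eq (hk : IsKernel k T) : hsNormSq T = ∫⁻ p, ‖k p‖ₑ ^ 2 ∂μ.prod μ := by
  obtain ⟨K, -, hin, h⟩ := exists_hasSum_box (stdBasis _) T hk.isHilbertSchmidt
  rw [← h, hk.toLp_eq hin, Lp.enorm_def, eLpNorm_congr_ae hk.memLp.coeFn_toLp, eLpNorm_two_sq]

theorem integrable_box (hk : MemLp k 2 (μ.prod μ)) (f h : Lp ℂ 2 μ) :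
    Integrable (fun p => k p * (f p.1 * conj (h p.2))) (μ.prod μ) := by
  have h1 := memLp_box (Lp.memLp f) (Lp.memLp h)
  have h2 := hk.integrable_mul h1.star
  refine h2.congr (ae_of_all _ fun p => ?_)
  simp [mul_comm]

theorem inner_apply (hk : IsKernel k T) (f h : Lp ℂ 2 μ) :
    ⟪h, T f⟫_ℂ = ∫ p, k p * (f p.1 * conj (h p.2)) ∂μ.prod μ := by
  rw [← hk.inner_eq, inner_box_left]
  refine integral_congr_ae ?_
  filter_upwards [hk.memLp.coeFn_toLp] with p hp
  rw [hp]

theorem of_inner_apply (hk : Measurable k) (hk2 : MemLp k 2 (μ.prod μ))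
    (h : ∀ f h, ⟪h, T f⟫_ℂ = ∫ p, k p * (f p.1 * conj (h p.2)) ∂μ.prod μ) : IsKernel k T := by
  refine ⟨hk, hk2, fun f h' => ?_⟩
  rw [h, inner_box_left]
  refine integral_congr_ae ?_
  filter_upwards [hk2.coeFn_toLp] with p hp
  rw [hp]

theorem ae_integrable (hk : IsKernel k T) (f : Lp ℂ 2 μ) :
    ∀ᵐ q ∂μ, Integrable (fun p => k (p, q) * f p) μ := by
  obtain ⟨w, hwm, hw0, -, -, hw⟩ := exists_weight μ
  have h1 := integrable_box hk.memLp f hw.toLp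
  filter_upwards [h1.prod_left_ae, hw.coeFn_toLp] with q hq hwq
  have h2 := hq.mul_const (conj (w q : ℂ))⁻¹
  refine h2.congr (ae_of_all _ fun p => ?_)
  have := (hw0 q).ne'
  simp only [hwq]
  have h4 : (w q : ℂ) ≠ 0 := by exact_mod_cast this
  rw [Complex.conj_ofReal]
  field_simp

/-- The weak identity, tested against `w` times indicators, gives equal set integrals of two
integrable functions; they agree almost everywhere, and the positive weight cancels. -/
theorem ae_apply_eq (hk : IsKernel k T) (f : Lp ℂ 2 μ) :
    T f =ᵐ[μ] fun q => ∫ p, k (p, q) * f p ∂μ := by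
  obtain ⟨w, hwm, hw0, -, -, hw⟩ := exists_weight μ
  have h1 := integrable_box hk.memLp f hw.toLp
  have h2 : (fun q => conj (w q : ℂ) * T f q) =ᵐ[μ]
      fun q => ∫ p, k (p, q) * (f p * conj (MemLp.toLp _ hw q)) ∂μ := by
    refine Integrable.ae_eq_of_forall_setIntegral_eq _ _
      (hw.star.integrable_mul (Lp.memLp (T f))) h1.integral_prod_right fun s hs _ => ?_
    have h3 := hk.inner_apply f (hw.indicator hs).toLp
    rw [integral_prod_symm _ (integrable_box hk.memLp f _), L2.inner_def] at h3
    rw [← integral_indicator hs, ← integral_indicator hs]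
    refine Eq.trans (integral_congr_ae ?_) (h3.trans (integral_congr_ae ?_))
    · filter_upwards [(hw.indicator hs).coeFn_toLp] with q hq
      rw [hq, RCLike.inner_apply]
      by_cases hqs : q ∈ s <;> simp [Set.indicator, hqs, mul_comm]
    · filter_upwards [(hw.indicator hs).coeFn_toLp, hw.coeFn_toLp] with q hq hq2
      simp only [hq]
      by_cases hqs : q ∈ s <;> simp [Set.indicator, hqs, hq2]
  filter_upwards [h2, hw.coeFn_toLp] with q hq hwq
  have := (hw0 q).ne'
  have h4 : (w q : ℂ) ≠ 0 := by exact_mod_cast this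
  rw [hwq] at hq
  simp only [Complex.conj_ofReal, ← mul_assoc] at hq
  rw [integral_mul_const, mul_comm] at hq
  exact mul_right_cancel₀ h4 hq

end IsKernel

end Kernels

/-! ### Composition and trace of integral operators -/

section Composition

open scoped ComplexConjugate

variable {X : Type*} [MeasurableSpace X]

/-- The kernel of the composition of two integral operators. -/
def compKernel (μ : Measure X) (k l : X × X → ℂ) (p : X × X) : ℂ :=
  ∫ r, k (p.1, r) * l (r, p.2) ∂μ

theorem enorm_compKernel_le (μ : Measure X) (k l : X × X → ℂ) (p : X × X) :
    ‖compKernel μ k l p‖ₑ ≤ ∫⁻ r, ‖k (p.1, r)‖ₑ * ‖l (r, p.2)‖ₑ ∂μ := by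
  refine (enorm_integral_le_lintegral_enorm _).trans_eq ?_
  simp only [enorm_mul]

variable {μ : Measure X} [SigmaFinite μ]

/-- Cauchy–Schwarz in the intermediate variable separates the two end points, and the remaining
double integral factors. -/
theorem lintegral_sq_lintegral_mul_le {a b : X × X → ℝ≥0∞} (ha : Measurable a)
    (hb : Measurable b) :
    ∫⁻ p, (∫⁻ r, a (p.1, r) * b (r, p.2) ∂μ) ^ 2 ∂μ.prod μ ≤
      (∫⁻ p, a p ^ 2 ∂μ.prod μ) * ∫⁻ p, b p ^ 2 ∂μ.prod μ := by
  have h1 : ∀ p : X × X, (∫⁻ r, a (p.1, r) * b (r, p.2) ∂μ) ^ 2 ≤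
      (∫⁻ r, a (p.1, r) ^ 2 ∂μ) * ∫⁻ r, b (r, p.2) ^ 2 ∂μ := fun p =>
    sq_lintegral_mul_le μ (by fun_prop) (by fun_prop)
  refine (lintegral_mono h1).trans_eq ?_
  rw [lintegral_prod_mul (f := fun x => ∫⁻ r, a (x, r) ^ 2 ∂μ)
    (g := fun y => ∫⁻ r, b (r, y) ^ 2 ∂μ)
    (Measurable.lintegral_prod_right' (f := fun p => a p ^ 2) (ha.pow_const 2)).aemeasurable
    (Measurable.lintegral_prod_left' (f := fun p => b p ^ 2) (hb.pow_const 2)).aemeasurable,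
    lintegral_prod _ (ha.pow_const 2).aemeasurable,
    lintegral_prod_symm _ (hb.pow_const 2).aemeasurable]

theorem ae_lintegral_mul_lt_top {a b : X × X → ℝ≥0∞} (ha : Measurable a) (hb : Measurable b)
    (ha2 : ∫⁻ p, a p ^ 2 ∂μ.prod μ < ∞) (hb2 : ∫⁻ p, b p ^ 2 ∂μ.prod μ < ∞) :
    ∀ᵐ p ∂μ.prod μ, ∫⁻ r, a (p.1, r) * b (r, p.2) ∂μ < ∞ := by
  have h1 := (lintegral_sq_lintegral_mul_le (μ := μ) ha hb).trans_lt (ENNReal.mul_lt_top ha2 hb2)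
  have h2 : Measurable fun p : X × X => ∫⁻ r, a (p.1, r) * b (r, p.2) ∂μ :=
    Measurable.lintegral_prod_right' (f := fun q : (X × X) × X => a (q.1.1, q.2) * b (q.2, q.1.2))
      (by fun_prop)
  filter_upwards [ae_lt_top (h2.pow_const 2) h1.ne] with p hp
  exact (ENNReal.pow_lt_top_iff.1 hp).resolve_right two_ne_zero

theorem measurable_compKernel {k l : X × X → ℂ} (hk : Measurable k) (hl : Measurable l) :
    Measurable (compKernel μ k l) := by
  refine StronglyMeasurable.measurable ?_
  refine StronglyMeasurable.integral_prod_right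
    (f := fun (p : X × X) (r : X) => k (p.1, r) * l (r, p.2)) (Measurable.stronglyMeasurable ?_)
  simp only [Function.uncurry_def]
  fun_prop

theorem ae_integrable_compKernel {k l : X × X → ℂ} (hk : Measurable k) (hl : Measurable l)
    (hk2 : MemLp k 2 (μ.prod μ)) (hl2 : MemLp l 2 (μ.prod μ)) :
    ∀ᵐ p ∂μ.prod μ, Integrable (fun r => k (p.1, r) * l (r, p.2)) μ := by
  filter_upwards [ae_lintegral_mul_lt_top hk.enorm hl.enorm (memLp_two_iff.1 hk2).2
    (memLp_two_iff.1 hl2).2] with p hp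
  refine ⟨Measurable.aestronglyMeasurable (by fun_prop), ?_⟩
  simpa only [HasFiniteIntegral, enorm_mul] using hp

theorem memLp_compKernel {k l : X × X → ℂ} (hk : Measurable k) (hl : Measurable l)
    (hk2 : MemLp k 2 (μ.prod μ)) (hl2 : MemLp l 2 (μ.prod μ)) :
    MemLp (compKernel μ k l) 2 (μ.prod μ) := by
  refine memLp_two_iff.2 ⟨(measurable_compKernel hk hl).aestronglyMeasurable, ?_⟩
  refine (lintegral_mono fun p => pow_le_pow_left' (enorm_compKernel_le μ k l p) 2).trans_lt ?_
  exact (lintegral_sq_lintegral_mul_le hk.enorm hl.enorm).trans_lt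
    (ENNReal.mul_lt_top (memLp_two_iff.1 hk2).2 (memLp_two_iff.1 hl2).2)

/-- Fubini for the triple integrand `Φ`, integrable by Cauchy–Schwarz between the composed absolute
kernels and `|f| ⊗ |h|`. Kernels map the first variable to the second, so the factor `C` acting
first comes first in `compKernel`. -/
theorem IsKernel.mul {k l : X × X → ℂ} {C D : Lp ℂ 2 μ →L[ℂ] Lp ℂ 2 μ} (hk : IsKernel k C)
    (hl : IsKernel l D) : IsKernel (compKernel μ k l) (D * C) := by
  have hkm := hk.measurable
  have hlm := hl.measurable
  have hm2 := memLp_compKernel hkm hlm hk.memLp hl.memLp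
  refine IsKernel.of_inner_apply (measurable_compKernel hkm hlm) hm2 fun f h => ?_
  have hfm : Measurable f := (Lp.stronglyMeasurable f).measurable
  have hhm : Measurable h := (Lp.stronglyMeasurable h).measurable
  have hconj : Measurable fun z : ℂ => conj z := Complex.continuous_conj.measurable
  let Φ : (X × X) × X → ℂ := fun q =>
    k (q.1.1, q.2) * l (q.2, q.1.2) * (f q.1.1 * conj (h q.1.2))
  have hΦm : Measurable Φ := by fun_prop
  have hΦ : Integrable Φ ((μ.prod μ).prod μ) := by
    refine ⟨hΦm.aestronglyMeasurable, ?_⟩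
    rw [HasFiniteIntegral, lintegral_prod _ hΦm.enorm.aemeasurable]
    have h1 : ∀ p : X × X, ∫⁻ r, ‖Φ (p, r)‖ₑ ∂μ =
        (∫⁻ r, ‖k (p.1, r)‖ₑ * ‖l (r, p.2)‖ₑ ∂μ) * (‖f p.1‖ₑ * ‖h p.2‖ₑ) := fun p => by
      rw [← lintegral_mul_const _ (by fun_prop)]
      refine lintegral_congr fun r => ?_
      simp only [Φ, enorm_mul, RCLike.enorm_conj]
    simp only [h1]
    have h2 : Measurable fun p : X × X => ∫⁻ r, ‖k (p.1, r)‖ₑ * ‖l (r, p.2)‖ₑ ∂μ :=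
      Measurable.lintegral_prod_right'
        (f := fun q : (X × X) × X => ‖k (q.1.1, q.2)‖ₑ * ‖l (q.2, q.1.2)‖ₑ) (by fun_prop)
    have h3 := sq_lintegral_mul_le (μ.prod μ) h2.aemeasurable
      (g := fun p : X × X => ‖f p.1‖ₑ * ‖h p.2‖ₑ) (by fun_prop)
    have h4 : ∫⁻ p : X × X, (‖f p.1‖ₑ * ‖h p.2‖ₑ) ^ 2 ∂μ.prod μ < ∞ := by
      simp only [mul_pow]
      rw [lintegral_prod_mul (f := fun x => ‖f x‖ₑ ^ 2) (g := fun x => ‖h x‖ₑ ^ 2)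
        (by fun_prop) (by fun_prop)]
      exact ENNReal.mul_lt_top (lintegral_enorm_sq_lt_top f) (lintegral_enorm_sq_lt_top h)
    have h5 := h3.trans_lt (ENNReal.mul_lt_top ((lintegral_sq_lintegral_mul_le hkm.enorm
      hlm.enorm).trans_lt (ENNReal.mul_lt_top (memLp_two_iff.1 hk.memLp).2
        (memLp_two_iff.1 hl.memLp).2)) h4)
    exact (ENNReal.pow_lt_top_iff.1 h5).resolve_right two_ne_zero
  have hR : ∫ p, compKernel μ k l p * (f p.1 * conj (h p.2)) ∂μ.prod μ =
      ∫ q, Φ q ∂(μ.prod μ).prod μ := by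
    rw [integral_prod _ hΦ]
    refine integral_congr_ae (ae_of_all _ fun p => ?_)
    simp only [compKernel, Φ]
    rw [integral_mul_const]
  rw [hR, integral_prod_symm _ hΦ, mul_apply_eq_comp, hl.inner_apply,
    integral_prod _ (IsKernel.integrable_box hl.memLp _ _)]
  refine integral_congr_ae ?_
  filter_upwards [hΦ.prod_left_ae, hk.ae_apply_eq f] with r hr hfr
  rw [integral_prod_symm _ hr]
  refine integral_congr_ae (ae_of_all _ fun q => ?_)
  simp only [Φ, hfr]
  rw [← integral_mul_const, ← integral_const_mul]
  refine integral_congr_ae (ae_of_all _ fun p => ?_)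
  ring

theorem IsKernel.integrable_mul_swap {c d : X × X → ℂ} {C D : Lp ℂ 2 μ →L[ℂ] Lp ℂ 2 μ}
    (hc : IsKernel c C) (hd : IsKernel d D) :
    Integrable (fun p => d p * c p.swap) (μ.prod μ) :=
  hd.memLp.integrable_mul (hc.memLp.comp_measurePreserving Measure.measurePreserving_swap)

/-- The trace of the composition of two integral operators. -/
theorem IsKernel.hasSum_inner_mul {c d : X × X → ℂ} {C D : Lp ℂ 2 μ →L[ℂ] Lp ℂ 2 μ}
    (hc : IsKernel c C) (hd : IsKernel d D) {ι : Type*} (b : HilbertBasis ι ℂ (Lp ℂ 2 μ)) :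
    HasSum (fun i => ⟪b i, (C * D) (b i)⟫_ℂ) (∫ p, d p * c p.swap ∂μ.prod μ) := by
  -- This is the kernel of the adjoint of `C`: the trace of `C * D` is the Hilbert–Schmidt inner
  -- product of `C*` with `D`, read off from the series for the kernel of `D`.
  have hs : MemLp (fun p => conj (c p.swap)) 2 (μ.prod μ) :=
    (hc.memLp.comp_measurePreserving Measure.measurePreserving_swap).star
  have h1 : HasSum (fun i => ⟪(MemLp.toLp _ hs : Lp ℂ 2 (μ.prod μ)), box (b i) (D (b i))⟫_ℂ)
      ⟪(MemLp.toLp _ hs : Lp ℂ 2 (μ.prod μ)), hd.memLp.toLp⟫_ℂ :=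
    (innerSL ℂ _).hasSum (hd.hasSum_box hd.isHilbertSchmidt b)
  have h2 : ⟪(MemLp.toLp _ hs : Lp ℂ 2 (μ.prod μ)), hd.memLp.toLp⟫_ℂ =
      ∫ p, d p * c p.swap ∂μ.prod μ := by
    rw [L2.inner_def]
    refine integral_congr_ae ?_
    filter_upwards [hs.coeFn_toLp, hd.memLp.coeFn_toLp] with p h2 h3
    rw [h2, h3, RCLike.inner_apply, Complex.conj_conj]
  have h3 : ∀ i, ⟪(MemLp.toLp _ hs : Lp ℂ 2 (μ.prod μ)), box (b i) (D (b i))⟫_ℂ =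
      ⟪b i, (C * D) (b i)⟫_ℂ := fun i => by
    rw [mul_apply_eq_comp, hc.inner_apply, L2.inner_def, ← integral_prod_swap]
    refine integral_congr_ae ?_
    have h4 := coeFn_box (b i) (D (b i))
    filter_upwards [(Measure.measurePreserving_swap
      (μ := μ) (ν := μ)).quasiMeasurePreserving.ae_eq_comp
      hs.coeFn_toLp, Measure.measurePreserving_swap.quasiMeasurePreserving.ae_eq_comp h4]
      with p h5 h6
    simp only [Function.comp_apply] at h5 h6
    rw [h5, h6, RCLike.inner_apply, Complex.conj_conj, Prod.swap_swap, Prod.fst_swap,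
      Prod.snd_swap]
    ring
  simpa only [h2, h3] using h1

end Composition

/-! ### Products with a counting measure -/

section ProdCount

variable {α ι : Type*} [MeasurableSpace α] [MeasurableSpace ι] [Countable ι]

/-- Writing the product as a sum of slices, each embedded measurably, lets the statements below
avoid measurability of the predicate or integrand. -/
theorem prod_count (m : Measure α) [SFinite m] :
    m.prod (Measure.count : Measure ι) = Measure.sum fun i => m.map fun x => (x, i) := by
  rw [Measure.count, Measure.prod_sum_right]
  simp only [Measure.prod_dirac]

variable [MeasurableSingletonClass ι]

theorem measurableEmbedding_prodMk_const (i : ι) :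
    MeasurableEmbedding fun x : α => (x, i) :=
  MeasurableEmbedding.id.prodMk_right i

theorem ae_prod_count_iff {m : Measure α} [SFinite m] {P : α × ι → Prop} :
    (∀ᵐ p ∂m.prod Measure.count, P p) ↔ ∀ i, ∀ᵐ x ∂m, P (x, i) := by
  rw [prod_count, Measure.ae_sum_iff]
  exact forall_congr' fun i => (measurableEmbedding_prodMk_const i).ae_map_iff

theorem lintegral_prod_count {m : Measure α} [SFinite m] (f : α × ι → ℝ≥0∞) :
    ∫⁻ p, f p ∂m.prod Measure.count = ∑' i, ∫⁻ x, f (x, i) ∂m := by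
  rw [prod_count, lintegral_sum_measure]
  exact tsum_congr fun i => (measurableEmbedding_prodMk_const i).lintegral_map f

theorem lintegral_prod_count' {m : Measure α} [SFinite m] {f : α × ι → ℝ≥0∞}
    (hf : ∀ i, AEMeasurable (fun x => f (x, i)) m) :
    ∫⁻ p, f p ∂m.prod Measure.count = ∫⁻ x, ∑' i, f (x, i) ∂m := by
  rw [lintegral_prod_count, lintegral_tsum hf]

theorem integral_count_eq_tsum {G : Type*} [NormedAddCommGroup G] [NormedSpace ℝ G]
    [CompleteSpace G] {f : ι → G} (hf : Integrable f Measure.count) :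
    ∫ i, f i ∂Measure.count = ∑' i, f i := by
  rw [integral_countable hf]
  simp

variable {β κ : Type*} [MeasurableSpace β] [MeasurableSpace κ] [MeasurableSingletonClass κ]
  [Countable κ]

variable (α β ι κ) in
/-- The exchange of the two middle factors, as a measurable equivalence. -/
def exchangeEquiv : (α × β) × (ι × κ) ≃ᵐ (α × ι) × (β × κ) where
  toEquiv := Equiv.prodProdProdComm α β ι κ
  measurable_toFun := by
    change Measurable fun q : (α × β) × (ι × κ) => ((q.1.1, q.2.1), (q.1.2, q.2.2))
    fun_prop
  measurable_invFun := by
    change Measurable fun q : (α × ι) × (β × κ) => ((q.1.1, q.2.1), (q.1.2, q.2.2))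
    fun_prop

theorem measurePreserving_exchangeEquiv (m : Measure α) (m' : Measure β) [SFinite m] [SFinite m'] :
    MeasurePreserving (exchangeEquiv α ι β κ) ((m.prod m').prod Measure.count)
      ((m.prod Measure.count).prod (m'.prod Measure.count)) := by
  refine ⟨(exchangeEquiv α ι β κ).measurable, ?_⟩
  rw [prod_count, prod_count, prod_count,
    Measure.map_sum (exchangeEquiv α ι β κ).measurable.aemeasurable, Measure.prod_sum]
  congr 1
  funext p
  rw [Measure.map_map (exchangeEquiv α ι β κ).measurable measurable_prodMk_right,
    Measure.map_prod_map _ _ measurable_prodMk_right measurable_prodMk_right]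
  rfl

end ProdCount

/-! ### Coordinates with respect to an orthonormal basis -/

section Coordinates

variable {H : Type*} [NormedAddCommGroup H] [InnerProductSpace ℂ H]

/-- Distinct orthonormal vectors have distance `√2`, so the balls of radius `1/2` around them are
disjoint open sets. -/
theorem _root_.Orthonormal.countable_of_separableSpace [TopologicalSpace.SeparableSpace H]
    {ι : Type*} {e : ι → H} (he : Orthonormal ℂ e) : Countable ι := by
  have h : (Set.univ : Set ι).Countable := by
    refine Set.PairwiseDisjoint.countable_of_isOpen (s := fun i => Metric.ball (e i) (1 / 2))
      ?_ (fun i _ => Metric.isOpen_ball) (fun i _ => ⟨e i, by simp⟩)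
    intro i _ j _ hij
    refine Metric.ball_disjoint_ball ?_
    have h1 : ‖e i - e j‖ ^ 2 = 2 := by
      rw [@norm_sub_sq ℂ, he.inner_eq_zero hij, he.norm_eq_one, he.norm_eq_one]
      norm_num
    rw [dist_eq_norm]
    nlinarith [norm_nonneg (e i - e j)]
  exact Set.countable_univ_iff.1 h

variable {F ι : Type*} [MeasurableSpace F] [Countable ι]

/-- The finite partial sums of the basis expansion are strongly measurable and converge pointwise;
countability of `ι` allows the limit along finite sets. -/
theorem stronglyMeasurable_of_coordinates (e : HilbertBasis ι ℂ H) {f : F → H}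
    (hf : ∀ i, Measurable fun x => ⟪e i, f x⟫_ℂ) : StronglyMeasurable f := by
  refine stronglyMeasurable_of_tendsto (f := fun (s : Finset ι) x => ∑ i ∈ s, ⟪e i, f x⟫_ℂ • e i)
    Filter.atTop (fun s => ?_) ?_
  · exact Finset.stronglyMeasurable_fun_sum s fun i _ =>
      (hf i).stronglyMeasurable.smul_const (e i)
  · rw [tendsto_pi_nhds]
    intro x
    have := e.hasSum_repr (f x)
    simp only [e.repr_apply_apply] at this
    exact this

/-- Two functions with almost everywhere equal coordinates are equal. -/
theorem ae_eq_of_coordinates {ν : Measure F} (e : HilbertBasis ι ℂ H) {f f' : F → H}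
    (h : ∀ i, ∀ᵐ x ∂ν, ⟪e i, f x⟫_ℂ = ⟪e i, f' x⟫_ℂ) : f =ᵐ[ν] f' := by
  filter_upwards [ae_all_iff.2 h] with x hx
  refine e.repr.injective ?_
  ext i
  rw [e.repr_apply_apply, e.repr_apply_apply, hx]

variable {ν : Measure F} [SigmaFinite ν] [MeasurableSpace ι] [MeasurableSingletonClass ι]
  [CompleteSpace H] (e : HilbertBasis ι ℂ H)

theorem measurable_coordinates {f : F → H} (hf : StronglyMeasurable f) :
    Measurable fun p : F × ι => ⟪e p.2, f p.1⟫_ℂ :=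
  measurable_from_prod_countable_left fun i => by
    have h : StronglyMeasurable fun x => ⟪e i, f x⟫_ℂ := stronglyMeasurable_const.inner hf
    exact h.measurable

theorem lintegral_coordinates {f : F → H} (hf : StronglyMeasurable f) :
    ∫⁻ p : F × ι, ‖⟪e p.2, f p.1⟫_ℂ‖ₑ ^ 2 ∂ν.prod Measure.count = ∫⁻ x, ‖f x‖ₑ ^ 2 ∂ν := by
  have hm := measurable_coordinates e hf
  rw [lintegral_prod_count' fun i => by
    have : Measurable fun x => ⟪e i, f x⟫_ℂ := hm.comp (measurable_prodMk_right (y := i))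
    fun_prop]
  simp only [tsum_enorm_inner_sq]

theorem memLp_coordinates (f : Lp H 2 ν) :
    MemLp (fun p : F × ι => ⟪e p.2, f p.1⟫_ℂ) 2 (ν.prod Measure.count) := by
  refine memLp_two_iff.2 ⟨(measurable_coordinates e
    (Lp.stronglyMeasurable f)).aestronglyMeasurable, ?_⟩
  rw [lintegral_coordinates e (Lp.stronglyMeasurable f)]
  exact lintegral_enorm_sq_lt_top f

/-- The isometry from `L²(F; H)` to `L²(F × ι)` given by an orthonormal basis. -/
def coordIsometry : Lp H 2 ν →ₗᵢ[ℂ] Lp ℂ 2 (ν.prod (Measure.count : Measure ι)) where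
  toFun f := (memLp_coordinates e f).toLp
  map_add' f f' := by
    rw [← MemLp.toLp_add, MemLp.toLp_eq_toLp_iff, Filter.EventuallyEq, ae_prod_count_iff]
    intro i
    filter_upwards [Lp.coeFn_add f f'] with x hx
    rw [hx, Pi.add_apply, inner_add_right, Pi.add_apply]
  map_smul' c f := by
    rw [RingHom.id_apply, ← MemLp.toLp_const_smul, MemLp.toLp_eq_toLp_iff, Filter.EventuallyEq,
      ae_prod_count_iff]
    intro i
    filter_upwards [Lp.coeFn_smul c f] with x hx
    rw [hx, Pi.smul_apply, inner_smul_right, Pi.smul_apply, smul_eq_mul]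
  norm_map' f := by
    change ‖(memLp_coordinates e f).toLp‖ = ‖f‖
    rw [← toReal_enorm, ← toReal_enorm]
    congr 1
    refine (ENNReal.pow_right_strictMono two_ne_zero).injective ?_
    change ‖(memLp_coordinates e f).toLp‖ₑ ^ 2 = ‖f‖ₑ ^ 2
    rw [← lintegral_enorm_sq_Lp f, ← lintegral_coordinates e (Lp.stronglyMeasurable f),
      Lp.enorm_def, eLpNorm_congr_ae (MemLp.coeFn_toLp _), eLpNorm_two_sq]

theorem coeFn_coordIsometry (f : Lp H 2 ν) :
    coordIsometry e f =ᵐ[ν.prod Measure.count] fun p : F × ι => ⟪e p.2, f p.1⟫_ℂ :=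
  MemLp.coeFn_toLp (memLp_coordinates e f)

/-- The range is complete, so it suffices that its orthogonal complement is zero. Pairing an
orthogonal `u` with the image of `x ↦ u (x, i) • e i` gives `∫ ‖u (x, i)‖² = 0` for each `i`. -/
theorem coordIsometry_surjective : Function.Surjective (coordIsometry (ν := ν) e) := by
  change Function.Surjective (coordIsometry (ν := ν) e).toLinearMap
  rw [← LinearMap.range_eq_top]
  have : CompleteSpace (LinearMap.range (coordIsometry (ν := ν) e).toLinearMap) :=
    (coordIsometry (ν := ν) e).isometry.isUniformInducing.isComplete_range.completeSpace_coe
  rw [← Submodule.orthogonal_eq_bot_iff, Submodule.eq_bot_iff]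
  intro u hu
  rw [Lp.eq_zero_iff_ae_eq_zero, Filter.EventuallyEq, ae_prod_count_iff]
  intro i
  have hum : Measurable fun x => u (x, i) :=
    (Lp.stronglyMeasurable u).measurable.comp measurable_prodMk_right
  have hu2 : ∫⁻ x, ‖u (x, i)‖ₑ ^ 2 ∂ν < ∞ := by
    refine lt_of_le_of_lt ?_ (lintegral_enorm_sq_lt_top u)
    rw [lintegral_prod_count]
    exact ENNReal.le_tsum (f := fun j => ∫⁻ x, ‖u (x, j)‖ₑ ^ 2 ∂ν) i
  have hv : MemLp (fun x => u (x, i) • e i) 2 ν := by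
    refine memLp_two_iff.2 ⟨(hum.stronglyMeasurable.smul_const _).aestronglyMeasurable, ?_⟩
    simpa [enorm_smul, ← ofReal_norm (e i), e.orthonormal.norm_eq_one] using hu2
  have h1 : ⟪coordIsometry e hv.toLp, u⟫_ℂ = 0 :=
    (Submodule.mem_orthogonal _ u).1 hu _ ⟨_, rfl⟩
  have h2 : (fun p => ⟪coordIsometry e hv.toLp p, u p⟫_ℂ) =ᵐ[ν.prod Measure.count] fun p =>
      ((({i} : Set ι).indicator (fun _ => ‖u p‖ ^ 2) p.2 : ℝ) : ℂ) := by
    rw [Filter.EventuallyEq, ae_prod_count_iff]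
    intro j
    filter_upwards [ae_prod_count_iff.1 (coeFn_coordIsometry e hv.toLp) j, hv.coeFn_toLp]
      with x h3 h4
    rw [h3]
    simp only [h4]
    rw [inner_smul_right]
    by_cases hij : j = i
    · subst hij
      rw [inner_self_eq_norm_sq_to_K, e.orthonormal.norm_eq_one, RCLike.inner_apply,
        Set.indicator_of_mem (Set.mem_singleton _), Complex.ofReal_pow, ← Complex.mul_conj']
      simp
    · rw [e.orthonormal.inner_eq_zero hij, Set.indicator_of_notMem (by simpa using hij)]
      simp
  rw [L2.inner_def, integral_congr_ae h2, integral_complex_ofReal, Complex.ofReal_eq_zero,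
    integral_eq_zero_iff_of_nonneg (fun p => Set.indicator_nonneg (fun _ _ => by positivity) _)]
    at h1
  · filter_upwards [ae_prod_count_iff.1 h1 i] with x hx
    simpa using hx
  · exact ((L2.integrable_inner _ _).congr h2).re

/-- The identification of `L²(F; H)` with `L²(F × ι)` given by an orthonormal basis. -/
def coordEquiv : Lp H 2 ν ≃ₗᵢ[ℂ] Lp ℂ 2 (ν.prod (Measure.count : Measure ι)) :=
  LinearIsometryEquiv.ofSurjective (coordIsometry e) (coordIsometry_surjective e)

variable (ν) in
/-- The identification of the Hilbert space tensor product of `L²(F)` and `H` with `L²(F × ι)`. -/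
def tensorEquiv : L2Tensor ν H ≃ₗᵢ[ℂ] Lp ℂ 2 (ν.prod (Measure.count : Measure ι)) :=
  (evalEquiv ν H).trans (coordEquiv e)

theorem coeFn_tensorEquiv (u : L2Tensor ν H) :
    tensorEquiv ν e u =ᵐ[ν.prod Measure.count] fun p : F × ι => ⟪e p.2, evalEquiv ν H u p.1⟫_ℂ :=
  coeFn_coordIsometry e _

theorem coeFn_tensorEquiv_elemTensor (f : Lp ℂ 2 ν) (h : H) :
    tensorEquiv ν e (elemTensor ν f h) =ᵐ[ν.prod Measure.count]
      fun p : F × ι => f p.1 * ⟪e p.2, h⟫_ℂ := by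
  refine (coeFn_tensorEquiv e _).trans ?_
  rw [Filter.EventuallyEq, ae_prod_count_iff]
  intro i
  filter_upwards [evalEquiv_elemTensor ν f h] with x hx
  rw [hx, inner_smul_right]

end Coordinates

/-! ### Transport of operators along a unitary -/

section Transport

variable {E K : Type*} [NormedAddCommGroup E] [InnerProductSpace ℂ E]
  [NormedAddCommGroup K] [InnerProductSpace ℂ K]

/-- Transport of bounded operators along a unitary. -/
def transport (V : E ≃ₗᵢ[ℂ] K) (T : E →L[ℂ] E) : K →L[ℂ] K :=
  (V : E →L[ℂ] K) ∘L T ∘L (V.symm : K →L[ℂ] E)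

variable (V : E ≃ₗᵢ[ℂ] K) (T : E →L[ℂ] E)

theorem transport_apply (u : K) : transport V T u = V (T (V.symm u)) := rfl

theorem transport_apply_apply (u : E) : transport V T (V u) = V (T u) := by
  rw [transport_apply, V.symm_apply_apply]

theorem transport_symm (T' : K →L[ℂ] K) : transport V (transport V.symm T') = T' := by
  ext u
  simp [transport_apply]

theorem transport_mul (T₁ T₂ : E →L[ℂ] E) :
    transport V (T₁ * T₂) = transport V T₁ * transport V T₂ := by
  ext u
  simp [transport_apply]

theorem transport_pow (n : ℕ) : transport V (T ^ (n + 1)) = transport V T ^ (n + 1) := by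
  induction n with
  | zero => simp
  | succ n ih => rw [pow_succ, transport_mul, ih, ← pow_succ]

/-- The image of an orthonormal basis under a unitary. -/
def mapBasis {κ : Type*} (b : HilbertBasis κ ℂ E) : HilbertBasis κ ℂ K :=
  HilbertBasis.ofRepr (V.symm.trans b.repr)

theorem mapBasis_apply {κ : Type*} (b : HilbertBasis κ ℂ E) (i : κ) :
    mapBasis V b i = V (b i) := by
  classical
  rw [← (mapBasis V b).repr_symm_single, ← b.repr_symm_single]
  rfl

variable [CompleteSpace E] [CompleteSpace K]

theorem hsNormSq_transport : hsNormSq (transport V T) = hsNormSq T := by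
  rw [hsNormSq_eq_tsum (mapBasis V (stdBasis E)), hsNormSq]
  refine tsum_congr fun i => ?_
  rw [mapBasis_apply, transport_apply_apply, ← ofReal_norm, V.norm_map, ofReal_norm]

theorem isHilbertSchmidt_transport : IsHilbertSchmidt (transport V T) ↔ IsHilbertSchmidt T := by
  rw [IsHilbertSchmidt, IsHilbertSchmidt, hsNormSq_transport]

/-- The trace is defined by one fixed basis; carrying that basis along with the operator makes basis
independence unnecessary. -/
theorem opTrace_eq_tsum_transport :
    opTrace T = ∑' i, ⟪mapBasis V (stdBasis E) i,
      transport V T (mapBasis V (stdBasis E) i)⟫_ℂ := by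
  refine tsum_congr fun i => ?_
  rw [mapBasis_apply, transport_apply_apply, V.inner_map_map]

end Transport

/-! ### Matrix entries of operator valued kernels -/

section Entries

variable {F ι : Type*} [MeasurableSpace F] {ν : Measure F} [SigmaFinite ν]
  [MeasurableSpace ι] [MeasurableSingletonClass ι] [Countable ι]

theorem ae_exchange_iff {P : (F × ι) × (F × ι) → Prop} :
    (∀ᵐ p ∂(ν.prod Measure.count).prod (ν.prod Measure.count), P p) ↔
      ∀ i j, ∀ᵐ q ∂ν.prod ν, P ((q.1, i), (q.2, j)) := by
  have h : MeasurePreserving (exchangeEquiv F ι F ι) _ _ := measurePreserving_exchangeEquiv ν ν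
  rw [← h.map_eq, (exchangeEquiv F ι F ι).measurableEmbedding.ae_map_iff, ae_prod_count_iff]
  exact Prod.forall

theorem lintegral_exchange {f : (F × ι) × (F × ι) → ℝ≥0∞} (hf : Measurable f) :
    ∫⁻ p, f p ∂(ν.prod Measure.count).prod (ν.prod Measure.count) =
      ∫⁻ q, ∑' i, ∑' j, f ((q.1, i), (q.2, j)) ∂ν.prod ν := by
  have h : MeasurePreserving (exchangeEquiv F ι F ι) _ _ := measurePreserving_exchangeEquiv ν ν
  rw [← h.lintegral_comp hf,
    lintegral_prod_count' (f := fun p => f (exchangeEquiv F ι F ι p)) fun p =>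
      Measurable.aemeasurable <|
    (hf.comp (exchangeEquiv F ι F ι).measurable).comp (measurable_prodMk_right (y := p))]
  refine lintegral_congr fun q => ?_
  rw [← ENNReal.tsum_prod]
  rfl

theorem integral_prod_count_of_support {f : F × ι → ℂ} (i : ι)
    (hf : ∀ᵐ p ∂ν.prod Measure.count, p.2 ≠ i → f p = 0) :
    ∫ p, f p ∂ν.prod Measure.count = ∫ x, f (x, i) ∂ν := by
  have h1 : (ν.prod (Measure.count : Measure ι)).restrict (Set.univ ×ˢ {i}) =
      ν.map fun x => (x, i) := by
    rw [← Measure.prod_restrict, Measure.restrict_univ, Measure.restrict_singleton,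
      Measure.count_singleton, one_smul, Measure.prod_dirac]
  rw [← setIntegral_eq_integral_of_ae_compl_eq_zero (s := Set.univ ×ˢ {i}), h1,
    (measurableEmbedding_prodMk_const i).integral_map]
  filter_upwards [hf] with p hp hps
  exact hp (by simpa using hps)

variable {H : Type*} [NormedAddCommGroup H] [InnerProductSpace ℂ H] (e : HilbertBasis ι ℂ H)

/-- The matrix entries `⟨eⱼ, v (x, σ) i⟩` of a family of vectors, as a function on
`(F × ι) × (F × ι)`. -/
def entries (v : F × F → ι → H) (p : (F × ι) × (F × ι)) : ℂ :=
  ⟪e p.2.2, v (p.1.1, p.2.1) p.1.2⟫_ℂ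

theorem measurable_entries {v : F × F → ι → H} (hv : ∀ i, StronglyMeasurable fun q => v q i) :
    Measurable (entries e v) := by
  have h : Measurable fun q : (F × F) × (ι × ι) => ⟪e q.2.2, v q.1 q.2.1⟫_ℂ :=
    measurable_from_prod_countable_left fun i => by
      have h : StronglyMeasurable fun q => ⟪e i.2, v q i.1⟫_ℂ :=
        stronglyMeasurable_const.inner (hv i.1)
      exact h.measurable
  exact h.comp (exchangeEquiv F ι F ι).symm.measurable

theorem lintegral_entries [CompleteSpace H] {v : F × F → ι → H}
    (hv : ∀ i, StronglyMeasurable fun q => v q i) :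
    ∫⁻ p, ‖entries e v p‖ₑ ^ 2 ∂(ν.prod Measure.count).prod (ν.prod Measure.count) =
      ∫⁻ q, ∑' i, ‖v q i‖ₑ ^ 2 ∂ν.prod ν := by
  rw [lintegral_exchange ((measurable_entries e hv).enorm.pow_const 2)]
  refine lintegral_congr fun q => tsum_congr fun i => ?_
  exact tsum_enorm_inner_sq e (v q i)

/-- Fubini, then Parseval for `⟨A* w, v⟩`: the intermediate index sum of a matrix product becomes
operator application. -/
theorem integral_inner_apply_mul [CompleteSpace H] {A : F → H →L[ℂ] H} {v : F → H} {w : H}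
    (h : Integrable (fun p : F × ι => ⟪w, A p.1 (e p.2)⟫_ℂ * ⟪e p.2, v p.1⟫_ℂ)
      (ν.prod Measure.count)) :
    ∫ p : F × ι, ⟪w, A p.1 (e p.2)⟫_ℂ * ⟪e p.2, v p.1⟫_ℂ ∂ν.prod Measure.count =
      ∫ y, ⟪w, A y (v y)⟫_ℂ ∂ν := by
  rw [integral_prod _ h]
  refine integral_congr_ae ?_
  filter_upwards [h.prod_right_ae] with y hy
  rw [integral_count_eq_tsum hy, ← ContinuousLinearMap.adjoint_inner_left,
    ← e.tsum_inner_mul_inner]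
  exact tsum_congr fun i => by rw [ContinuousLinearMap.adjoint_inner_left]

theorem measurable_hsNormSq [CompleteSpace H] (e : HilbertBasis ι ℂ H) {S : F → H →L[ℂ] H}
    (hS : ∀ h, StronglyMeasurable fun x => S x h) : Measurable fun x => hsNormSq (S x) := by
  simp only [hsNormSq_eq_tsum e]
  exact Measurable.tsum fun i => (hS (e i)).enorm.pow_const 2

end Entries

/-! ### The operators with kernel `g (x, σ) S x` -/

section Operator

variable {F ι : Type*} [MeasurableSpace F] {ν : Measure F} [SigmaFinite ν]
  [MeasurableSpace ι] [MeasurableSingletonClass ι] [Countable ι]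
  {H : Type*} [NormedAddCommGroup H] [InnerProductSpace ℂ H] [CompleteSpace H]
  (e : HilbertBasis ι ℂ H) {g : F × F → ℂ} {S : F → H →L[ℂ] H}

/-- The columns `g (x, σ) S x eᵢ` of the operator valued kernel. -/
def columns (g : F × F → ℂ) (S : F → H →L[ℂ] H) (q : F × F) (i : ι) : H := g q • S q.1 (e i)

theorem stronglyMeasurable_columns (hg : Measurable g)
    (hS : ∀ h, StronglyMeasurable fun x => S x h) (i : ι) :
    StronglyMeasurable fun q => columns e g S q i :=
  hg.stronglyMeasurable.smul ((hS (e i)).comp_measurable measurable_fst)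

theorem lintegral_columns (hg : Measurable g) (hS : ∀ h, StronglyMeasurable fun x => S x h) :
    ∫⁻ p, ‖entries e (columns e g S) p‖ₑ ^ 2 ∂(ν.prod Measure.count).prod (ν.prod Measure.count) =
      kernelIntegral ν g S := by
  rw [lintegral_entries e (stronglyMeasurable_columns e hg hS)]
  have h1 : ∀ q : F × F, ∑' i, ‖columns e g S q i‖ₑ ^ 2 = ‖g q‖ₑ ^ 2 * hsNormSq (S q.1) :=
    fun q => by
      rw [hsNormSq_eq_tsum e, ← ENNReal.tsum_mul_left]
      exact tsum_congr fun i => by rw [columns, enorm_smul, mul_pow]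
  have h2 := measurable_hsNormSq e hS
  simp only [h1]
  rw [lintegral_prod (fun q : F × F => ‖g q‖ₑ ^ 2 * hsNormSq (S q.1))
    ((hg.enorm.pow_const 2).mul (h2.comp measurable_fst)).aemeasurable,
    kernelIntegral]
  refine lintegral_congr fun x => ?_
  have h3 : Measurable fun σ => ‖g (x, σ)‖ₑ ^ 2 := by fun_prop
  exact lintegral_mul_const (hsNormSq (S x)) h3

theorem memLp_columns (hg : Measurable g) (hS : ∀ h, StronglyMeasurable fun x => S x h)
    (h : kernelIntegral ν g S < ∞) :
    MemLp (entries e (columns e g S)) 2 ((ν.prod Measure.count).prod (ν.prod Measure.count)) :=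
  memLp_two_iff.2 ⟨(measurable_entries e (stronglyMeasurable_columns e hg hS)).aestronglyMeasurable,
    by rwa [lintegral_columns e hg hS]⟩

/-- For fixed `σ`, Cauchy–Schwarz pairs `|g (x, σ)| ‖S x h‖` with `|f|`; the former is square
integrable in `x` for almost all `σ` since `‖S x h‖ ≤ ‖S x‖₂ ‖h‖`. -/
theorem ae_integrable_of_kernelIntegral (hg : Measurable g)
    (hS : ∀ h, StronglyMeasurable fun x => S x h) (hk : kernelIntegral ν g S < ∞)
    (f : Lp ℂ 2 ν) (h : H) :
    ∀ᵐ σ ∂ν, Integrable (fun x => (g (x, σ) * f x) • S x h) ν := by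
  have hSm : Measurable fun x => ‖S x h‖ₑ := (hS h).enorm
  have hfm : Measurable f := (Lp.stronglyMeasurable f).measurable
  have h1 : ∫⁻ σ, ∫⁻ x, (‖g (x, σ)‖ₑ * ‖S x h‖ₑ) ^ 2 ∂ν ∂ν < ∞ := by
    rw [← lintegral_prod_symm (f := fun q : F × F => (‖g q‖ₑ * ‖S q.1 h‖ₑ) ^ 2) (by fun_prop),
      lintegral_prod _ (by fun_prop)]
    refine lt_of_le_of_lt ?_ (ENNReal.mul_lt_top hk (ENNReal.pow_lt_top (enorm_lt_top (x := h))
      (n := 2)))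
    rw [kernelIntegral, ← lintegral_mul_const' _ _ (ENNReal.pow_lt_top enorm_lt_top).ne]
    refine lintegral_mono fun x => ?_
    simp only [mul_pow]
    rw [lintegral_mul_const _ (by fun_prop), mul_assoc]
    gcongr
    exact enorm_apply_sq_le _ _
  have h2 : Measurable fun σ => ∫⁻ x, (‖g (x, σ)‖ₑ * ‖S x h‖ₑ) ^ 2 ∂ν :=
    Measurable.lintegral_prod_left' (f := fun q : F × F => (‖g q‖ₑ * ‖S q.1 h‖ₑ) ^ 2)
      (by fun_prop)
  filter_upwards [ae_lt_top h2 h1.ne] with σ hσ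
  refine ⟨(Measurable.stronglyMeasurable (by fun_prop)).aestronglyMeasurable.smul
    (hS h).aestronglyMeasurable, ?_⟩
  have h3 := (sq_lintegral_mul_le ν (f := fun x => ‖g (x, σ)‖ₑ * ‖S x h‖ₑ) (g := fun x => ‖f x‖ₑ)
    (by fun_prop) (by fun_prop)).trans_lt (ENNReal.mul_lt_top hσ (lintegral_enorm_sq_lt_top f))
  have h4 := (ENNReal.pow_lt_top_iff.1 h3).resolve_right two_ne_zero
  rw [HasFiniteIntegral]
  refine lt_of_eq_of_lt (lintegral_congr fun x => ?_) h4
  rw [enorm_smul, enorm_mul]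
  ring

theorem isGivenBy_of_isKernel (hg : Measurable g)
    (hS : ∀ h, StronglyMeasurable fun x => S x h) (hk : kernelIntegral ν g S < ∞)
    {T : L2Tensor ν H →L[ℂ] L2Tensor ν H}
    (hT : IsKernel (entries e (columns e g S)) (transport (tensorEquiv ν e) T)) :
    IsGivenBy ν g S T := by
  intro f h
  have hint := ae_integrable_of_kernelIntegral hg hS hk f h
  refine hint.and (ae_eq_of_coordinates e fun j => ?_)
  have h1 := hT.ae_apply_eq (tensorEquiv ν e (elemTensor ν f h))
  have h2 := hT.ae_integrable (tensorEquiv ν e (elemTensor ν f h))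
  rw [transport_apply_apply] at h1
  filter_upwards [ae_prod_count_iff.1 (coeFn_tensorEquiv e (T (elemTensor ν f h))) j,
    ae_prod_count_iff.1 h1 j, ae_prod_count_iff.1 h2 j, hint] with σ h3 h4 h5 h6
  rw [← h3, h4, ← integral_inner h6]
  have h7 : (fun p => entries e (columns e g S) (p, (σ, j)) * tensorEquiv ν e (elemTensor ν f h) p)
      =ᵐ[ν.prod Measure.count] fun p : F × ι =>
        ⟪e j, ((g (p.1, σ) * f p.1) • S p.1) (e p.2)⟫_ℂ * ⟪e p.2, h⟫_ℂ := by
    filter_upwards [coeFn_tensorEquiv_elemTensor e f h] with p hp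
    rw [hp, entries, columns, smul_apply, inner_smul_right, inner_smul_right]
    ring
  rw [integral_congr_ae h7, integral_inner_apply_mul e (v := fun _ => h)
    (A := fun x => (g (x, σ) * f x) • S x) (h5.congr h7)]
  rfl

/-- Finiteness of `kernelIntegral` is not available here, being a conclusion. Instead an abstract
kernel `k` of `T` is compared with the expected one entry by entry, on rectangles, after weighting
both to be integrable. -/
theorem isKernel_of_isGivenBy (hg : Measurable g)
    (hS : ∀ h, StronglyMeasurable fun x => S x h) {T : L2Tensor ν H →L[ℂ] L2Tensor ν H}
    (hT : IsGivenBy ν g S T) (hHS : IsHilbertSchmidt T) :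
    IsKernel (entries e (columns e g S)) (transport (tensorEquiv ν e) T) := by
  obtain ⟨k, hk⟩ := ((isHilbertSchmidt_transport (tensorEquiv ν e) T).2 hHS).exists_isKernel
  refine hk.congr (measurable_entries e (stronglyMeasurable_columns e hg hS))
    (ae_exchange_iff.2 fun i j => ?_)
  have hkm : Measurable fun q : F × F => k ((q.1, i), (q.2, j)) :=
    hk.measurable.comp (by fun_prop)
  set s : F → ℂ := fun x => ⟪e j, S x (e i)⟫_ℂ with hs
  have hsm : Measurable s := by
    have h : StronglyMeasurable s := stronglyMeasurable_const.inner (hS (e i))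
    exact h.measurable
  obtain ⟨w, hwm, hw0, hw1, hwi, hw⟩ := exists_weight ν
  have hwm' : Measurable fun x => (w x : ℂ) := by fun_prop
  -- Almost everywhere finite by the absolute convergence required in `IsGivenBy`, applied to `w ⊗
  -- eᵢ`.
  let N : F → ℝ≥0∞ := fun σ => ∫⁻ x, ‖g (x, σ) * w x * s x‖ₑ ∂ν
  have hNm : Measurable N := Measurable.lintegral_prod_left'
    (f := fun q : F × F => ‖g q * w q.1 * s q.1‖ₑ) (by fun_prop)
  have hN : ∀ᵐ σ ∂ν, N σ < ∞ := by
    filter_upwards [hT hw.toLp (e i)] with σ hσ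
    have h1 : Integrable (fun x => ⟪e j, (g (x, σ) * MemLp.toLp _ hw x) • S x (e i)⟫_ℂ) ν :=
      hσ.1.const_inner (e j)
    refine Integrable.hasFiniteIntegral (h1.congr ?_)
    filter_upwards [hw.coeFn_toLp] with x hx
    rw [inner_smul_right, hx]
  -- Chosen so that `N σ * w' σ ≤ w σ` wherever `N σ` is finite, which makes the weighted formula
  -- kernel integrable; `w' ≤ w` keeps it in L².
  let w' : F → ℝ := fun σ => w σ / (1 + (N σ).toReal)
  have hw0' : ∀ σ, 0 < w' σ := fun σ => by have := hw0 σ; positivity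
  have hw'm : Measurable w' := by fun_prop
  have hw'w : ∀ σ, w' σ ≤ w σ := fun σ =>
    div_le_self (hw0 σ).le (le_add_of_nonneg_right ENNReal.toReal_nonneg)
  have hw2' : MemLp (fun σ => (w' σ : ℂ)) 2 ν := by
    refine hw.mono (by fun_prop) (ae_of_all _ fun σ => ?_)
    rw [Complex.norm_real, Complex.norm_real, Real.norm_of_nonneg (hw0' σ).le,
      Real.norm_of_nonneg (hw0 σ).le]
    exact hw'w σ
  have hk2 : MemLp (fun q : F × F => k ((q.1, i), (q.2, j))) 2 (ν.prod ν) := by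
    refine memLp_two_iff.2 ⟨hkm.aestronglyMeasurable, ?_⟩
    have h1 := (memLp_two_iff.1 hk.memLp).2
    rw [lintegral_exchange (hk.measurable.enorm.pow_const 2)] at h1
    refine lt_of_le_of_lt (lintegral_mono fun q => ?_) h1
    exact (ENNReal.le_tsum (f := fun j => ‖k ((q.1, i), (q.2, j))‖ₑ ^ 2) j).trans
      (ENNReal.le_tsum (f := fun i => ∑' j, ‖k ((q.1, i), (q.2, j))‖ₑ ^ 2) i)
  have hψ₁ : Integrable (fun q : F × F => k ((q.1, i), (q.2, j)) * w q.1 * w' q.2)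
      (ν.prod ν) := by
    have h1 := hk2.integrable_mul (memLp_box hw hw2')
    refine h1.congr (ae_of_all _ fun q => ?_)
    simp only [Pi.mul_apply, Complex.conj_ofReal]
    ring
  have hψ₂ : Integrable (fun q : F × F => g q * w q.1 * s q.1 * w' q.2) (ν.prod ν) := by
    have hm : Measurable fun q : F × F => g q * w q.1 * s q.1 * (w' q.2 : ℂ) := by fun_prop
    refine ⟨hm.aestronglyMeasurable, ?_⟩
    rw [HasFiniteIntegral, lintegral_prod_symm _ hm.enorm.aemeasurable]
    refine lt_of_le_of_lt (lintegral_mono_ae ?_) hwi.hasFiniteIntegral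
    filter_upwards [hN] with σ hσ
    have h1 : ∫⁻ x, ‖g (x, σ) * w x * s x * (w' σ : ℂ)‖ₑ ∂ν = N σ * ‖(w' σ : ℂ)‖ₑ := by
      rw [← lintegral_mul_const _ (by fun_prop)]
      exact lintegral_congr fun x => enorm_mul _ _
    rw [h1, ← ENNReal.ofReal_toReal hσ.ne, ← ofReal_norm, ← ofReal_norm,
      ← ENNReal.ofReal_mul ENNReal.toReal_nonneg]
    refine ENNReal.ofReal_le_ofReal ?_
    rw [Complex.norm_real, Real.norm_of_nonneg (hw0' σ).le, Real.norm_of_nonneg (hw0 σ).le,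
      mul_div_assoc', div_le_iff₀ (by positivity)]
    nlinarith [hw0 σ, ENNReal.toReal_nonneg (a := N σ)]
  -- Evaluate `T` on `(1_A w) ⊗ eᵢ` in two ways and take the `j`-th coordinate; the tensor lives on
  -- the slice of index `i` only.
  have key : ∀ A, MeasurableSet A → ∀ᵐ σ ∂ν, ∫ x in A, k ((x, i), (σ, j)) * w x ∂ν =
      ∫ x in A, g (x, σ) * w x * s x ∂ν := by
    intro A hA
    set f : Lp ℂ 2 ν := (hw.indicator hA).toLp
    have hf : f =ᵐ[ν] A.indicator fun x => (w x : ℂ) := MemLp.coeFn_toLp _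
    have h1 := hk.ae_apply_eq (tensorEquiv ν e (elemTensor ν f (e i)))
    rw [transport_apply_apply] at h1
    filter_upwards [ae_prod_count_iff.1 (coeFn_tensorEquiv e (T (elemTensor ν f (e i)))) j,
      ae_prod_count_iff.1 h1 j, hT f (e i)] with σ h3 h4 h5
    rw [h4, h5.2, ← integral_inner h5.1, integral_prod_count_of_support i] at h3
    · rw [← integral_indicator hA, ← integral_indicator hA]
      refine Eq.trans (integral_congr_ae ?_) (h3.trans (integral_congr_ae ?_))
      · filter_upwards [hf, ae_prod_count_iff.1 (coeFn_tensorEquiv_elemTensor e f (e i)) i]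
          with x h6 h7
        rw [h7, h6, inner_self_eq_norm_sq_to_K, e.orthonormal.norm_eq_one]
        by_cases hx : x ∈ A <;> simp [hx]
      · filter_upwards [hf] with x h6
        rw [h6, inner_smul_right]
        by_cases hx : x ∈ A <;> simp [hx, s]
    · filter_upwards [coeFn_tensorEquiv_elemTensor e f (e i)] with p h6 h7
      rw [h6, e.orthonormal.inner_eq_zero h7, mul_zero, mul_zero]
  have hae := ae_eq_zero_of_forall_setIntegral_rectangle (hψ₁.sub hψ₂) fun A B hA hB => by
    rw [integral_sub' hψ₁.integrableOn hψ₂.integrableOn, sub_eq_zero]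
    have h1 := hψ₁.integrableOn (s := A ×ˢ B)
    have h2 := hψ₂.integrableOn (s := A ×ˢ B)
    rw [IntegrableOn, ← Measure.prod_restrict] at h1 h2
    rw [← Measure.prod_restrict, integral_prod_symm _ h1, integral_prod_symm _ h2]
    refine integral_congr_ae (ae_restrict_of_ae ?_)
    filter_upwards [key A hA] with σ hσ
    rw [integral_mul_const, integral_mul_const, hσ]
  filter_upwards [hae] with q hq
  have h1 : (w q.1 : ℂ) ≠ 0 := by exact_mod_cast (hw0 q.1).ne'
  have h2 : (w' q.2 : ℂ) ≠ 0 := by exact_mod_cast (hw0' q.2).ne'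
  have h3 := sub_eq_zero.1 hq
  have h4 := mul_right_cancel₀ h2 h3
  rw [mul_right_comm] at h4
  rw [mul_right_cancel₀ h1 h4, entries, columns, inner_smul_right]

end Operator

/-! ### Paths -/

section Paths

variable {F : Type*} [MeasurableSpace F]

/-- Appending a point, as a measurable equivalence. -/
def snocEquiv (F : Type*) [MeasurableSpace F] (n : ℕ) : (Fin n → F) × F ≃ᵐ (Fin (n + 1) → F) :=
  MeasurableEquiv.prodComm.trans (MeasurableEquiv.piFinSuccAbove (fun _ => F) (Fin.last n)).symm

theorem snocEquiv_apply {n : ℕ} (q : (Fin n → F) × F) :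
    snocEquiv F n q = (Fin.snoc q.1 q.2 : Fin (n + 1) → F) := by
  change Fin.insertNth (α := fun _ => F) (Fin.last n) q.2 q.1 = _
  rw [Fin.insertNth_last']

theorem measurePreserving_snocEquiv (ν : Measure F) [SigmaFinite ν] (n : ℕ) :
    MeasurePreserving (snocEquiv F n) ((Measure.pi fun _ => ν).prod ν) (Measure.pi fun _ => ν) :=
  ((measurePreserving_piFinSuccAbove (fun _ => ν) (Fin.last n)).symm _).comp
    Measure.measurePreserving_swap

/-- Prepending a point, as a measurable equivalence. -/
def consEquiv (F : Type*) [MeasurableSpace F] (n : ℕ) : F × (Fin n → F) ≃ᵐ (Fin (n + 1) → F) :=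
  (MeasurableEquiv.piFinSuccAbove (fun _ => F) 0).symm

theorem consEquiv_apply {n : ℕ} (q : F × (Fin n → F)) :
    consEquiv F n q = (Fin.cons q.1 q.2 : Fin (n + 1) → F) := by
  change Fin.insertNth (α := fun _ => F) 0 q.1 q.2 = _
  rw [Fin.insertNth_zero']

theorem measurePreserving_consEquiv (ν : Measure F) [SigmaFinite ν] (n : ℕ) :
    MeasurePreserving (consEquiv F n) (ν.prod (Measure.pi fun _ => ν)) (Measure.pi fun _ => ν) :=
  (measurePreserving_piFinSuccAbove (fun _ => ν) 0).symm _

/-- Paths with prescribed end points, as a measurable equivalence. -/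
def pathEquiv (F : Type*) [MeasurableSpace F] (m : ℕ) :
    (F × F) × (Fin m → F) ≃ᵐ (Fin (m + 2) → F) :=
  ((MeasurableEquiv.prodCongr MeasurableEquiv.prodComm (MeasurableEquiv.refl _)).trans
    (MeasurableEquiv.prodAssoc.trans
      ((MeasurableEquiv.prodCongr (MeasurableEquiv.refl _) (consEquiv F m)).trans
        MeasurableEquiv.prodComm))).trans (snocEquiv F (m + 1))

theorem pathEquiv_apply {m : ℕ} (q : (F × F) × (Fin m → F)) :
    pathEquiv F m q =
      (Fin.snoc (Fin.cons q.1.1 q.2 : Fin (m + 1) → F) q.1.2 : Fin (m + 2) → F) := by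
  change snocEquiv F (m + 1) (consEquiv F m (q.1.1, q.2), q.1.2) = _
  rw [snocEquiv_apply, consEquiv_apply]

theorem measurePreserving_pathEquiv (ν : Measure F) [SigmaFinite ν] (m : ℕ) :
    MeasurePreserving (pathEquiv F m) ((ν.prod ν).prod (Measure.pi fun _ => ν))
      (Measure.pi fun _ => ν) := by
  have h1 : MeasurePreserving (Prod.map Prod.swap id : (F × F) × (Fin m → F) → _)
      ((ν.prod ν).prod (Measure.pi fun _ => ν)) ((ν.prod ν).prod (Measure.pi fun _ => ν)) :=
    Measure.measurePreserving_swap.prod (MeasurePreserving.id _)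
  have h2 : MeasurePreserving (MeasurableEquiv.prodAssoc : (F × F) × (Fin m → F) ≃ᵐ _)
      ((ν.prod ν).prod (Measure.pi fun _ => ν)) (ν.prod (ν.prod (Measure.pi fun _ => ν))) :=
    measurePreserving_prodAssoc _ _ _
  have h3 := (MeasurePreserving.id ν).prod (measurePreserving_consEquiv ν m)
  have h4 : MeasurePreserving (Prod.swap : F × (Fin (m + 1) → F) → _) _ _ :=
    Measure.measurePreserving_swap (μ := ν) (ν := Measure.pi fun _ => ν)
  exact (measurePreserving_snocEquiv ν (m + 1)).comp (h4.comp (h3.comp (h2.comp h1)))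

end Paths

/-! ### Weights and products along paths -/

section Products

variable {F H : Type*} [NormedAddCommGroup H] [InnerProductSpace ℂ H]

theorem pathWeight_snoc {n : ℕ} (g : F × F → ℂ) (z : Fin n → F) (s σ : F) :
    pathWeight g (Fin.snoc z s : Fin (n + 1) → F) σ = pathWeight g z s * g (s, σ) := by
  rw [pathWeight, Fin.prod_univ_castSucc]
  congr 1
  · refine Finset.prod_congr rfl fun j _ => ?_
    rw [← Fin.castSucc_succ, Fin.snoc_castSucc, Fin.snoc_castSucc]
  · rw [Fin.snoc_last, Fin.succ_last, Fin.snoc_last]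

theorem opProd_snoc {n : ℕ} (S : F → H →L[ℂ] H) (z : Fin n → F) (s : F) :
    opProd S (Fin.snoc z s : Fin (n + 1) → F) = S s * opProd S z := by
  rw [opProd, opProd, List.ofFn_succ', List.concat_eq_append, List.reverse_append]
  simp [Fin.snoc_castSucc, Fin.snoc_last]

theorem cyclicWeight_snoc {n : ℕ} (g : F × F → ℂ) (z : Fin (n + 1) → F) (σ : F) :
    cyclicWeight g (Fin.snoc z σ : Fin (n + 2) → F) = pathWeight g z σ * g (σ, z 0) := by
  rw [cyclicWeight, Fin.prod_univ_castSucc]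
  congr 1
  · refine Finset.prod_congr rfl fun j _ => ?_
    rw [finRotate_apply, Fin.coeSucc_eq_succ, Fin.snoc_castSucc]
  · rw [finRotate_last, Fin.snoc_last, Fin.snoc_apply_zero]

theorem pathWeight_zero (g : F × F → ℂ) (z : Fin 0 → F) (σ : F) : pathWeight g z σ = 1 := rfl

theorem opProd_zero (S : F → H →L[ℂ] H) (z : Fin 0 → F) : opProd S z = 1 := rfl

theorem cons_eq_snoc (x : F) (y : Fin 0 → F) :
    (Fin.cons x y : Fin 1 → F) = (Fin.snoc y x : Fin 1 → F) := by
  ext j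
  fin_cases j
  rfl

theorem powKernelIntegrand_zero (g : F × F → ℂ) (S : F → H →L[ℂ] H) (x σ : F) (h : H)
    (y : Fin 0 → F) : powKernelIntegrand g S x σ h y = g (x, σ) • S x h := by
  rw [powKernelIntegrand, cons_eq_snoc, pathWeight_snoc, opProd_snoc, pathWeight_zero, opProd_zero,
    one_mul, mul_one]

/-- Paths grow at their end, matching left multiplication by `T` in the induction on powers. -/
theorem powKernelIntegrand_snoc {m : ℕ} (g : F × F → ℂ) (S : F → H →L[ℂ] H) (x s σ : F) (h : H)
    (y : Fin m → F) :
    powKernelIntegrand g S x σ h (Fin.snoc y s : Fin (m + 1) → F) =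
      (g (s, σ) • S s) (powKernelIntegrand g S x s h y) := by
  rw [powKernelIntegrand, powKernelIntegrand, Fin.cons_snoc_eq_snoc_cons, pathWeight_snoc,
    opProd_snoc, mul_apply_eq_comp, smul_apply, map_smul, smul_smul, mul_comm]

end Products

/-! ### Measurability -/

section Measurability

variable {F H : Type*} [MeasurableSpace F] [NormedAddCommGroup H] [InnerProductSpace ℂ H]

theorem stronglyMeasurable_family_apply {α ι : Type*} [MeasurableSpace α] [Countable ι]
    (e : HilbertBasis ι ℂ H) {S : F → H →L[ℂ] H} (hS : ∀ h, StronglyMeasurable fun x => S x h)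
    {a : α → F} {v : α → H} (ha : Measurable a) (hv : StronglyMeasurable v) :
    StronglyMeasurable fun t => S (a t) (v t) := by
  refine stronglyMeasurable_of_tendsto
    (f := fun (s : Finset ι) t => ∑ i ∈ s, ⟪e i, v t⟫_ℂ • S (a t) (e i)) Filter.atTop
    (fun s => Finset.stronglyMeasurable_fun_sum s fun i _ => ?_) ?_
  · have h1 : StronglyMeasurable fun t => ⟪e i, v t⟫_ℂ := stronglyMeasurable_const.inner hv
    exact h1.smul ((hS (e i)).comp_measurable ha)
  · rw [tendsto_pi_nhds]
    intro t
    have h1 := (S (a t)).hasSum (e.hasSum_repr (v t))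
    simp only [e.repr_apply_apply, map_smul] at h1
    exact h1

theorem stronglyMeasurable_opProd {ι : Type*} [Countable ι] (e : HilbertBasis ι ℂ H)
    {S : F → H →L[ℂ] H} (hS : ∀ h, StronglyMeasurable fun x => S x h) (n : ℕ) (h : H) :
    StronglyMeasurable fun z : Fin n → F => opProd S z h := by
  induction n with
  | zero => exact stronglyMeasurable_const' (fun _ _ => rfl)
  | succ n ih =>
    have h1 : (fun z : Fin (n + 1) → F => opProd S z h) =
        fun z => S (z (Fin.last n)) (opProd S (Fin.init z) h) := by
      funext z
      rw [← mul_apply_eq_comp, ← opProd_snoc, Fin.snoc_init_self]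
    rw [h1]
    refine stronglyMeasurable_family_apply e hS (measurable_pi_apply _) (ih.comp_measurable ?_)
    exact measurable_pi_lambda _ fun j => measurable_pi_apply _

theorem measurable_pathWeight {g : F × F → ℂ} (hg : Measurable g) (n : ℕ) :
    Measurable fun q : (Fin n → F) × F => pathWeight g q.1 q.2 := by
  refine Finset.measurable_prod _ fun j _ => hg.comp (Measurable.prodMk (by fun_prop) ?_)
  have h1 : Measurable fun q : (Fin n → F) × F => snocEquiv F n q j.succ :=
    (measurable_pi_apply _).comp (snocEquiv F n).measurable
  simpa only [snocEquiv_apply] using h1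

theorem measurable_cons (m : ℕ) :
    Measurable fun q : (F × F) × (Fin m → F) => (Fin.cons q.1.1 q.2 : Fin (m + 1) → F) := by
  have h1 : Measurable fun q : (F × F) × (Fin m → F) => consEquiv F m (q.1.1, q.2) := by fun_prop
  simpa only [consEquiv_apply] using h1

theorem measurable_pathWeight_cons {g : F × F → ℂ} (hg : Measurable g) (m : ℕ) :
    Measurable fun q : (F × F) × (Fin m → F) =>
      pathWeight g (Fin.cons q.1.1 q.2 : Fin (m + 1) → F) q.1.2 :=
  (measurable_pathWeight hg (m + 1)).comp ((measurable_cons m).prodMk (by fun_prop))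

theorem stronglyMeasurable_powKernelIntegrand {ι : Type*} [Countable ι] (e : HilbertBasis ι ℂ H)
    {g : F × F → ℂ} (hg : Measurable g) {S : F → H →L[ℂ] H}
    (hS : ∀ h, StronglyMeasurable fun x => S x h) (m : ℕ) (h : H) :
    StronglyMeasurable fun q : (F × F) × (Fin m → F) =>
      powKernelIntegrand g S q.1.1 q.1.2 h q.2 :=
  (measurable_pathWeight_cons hg m).stronglyMeasurable.smul
    ((stronglyMeasurable_opProd e hS (m + 1) h).comp_measurable (measurable_cons m))

end Measurability

/-! ### Majorants -/

/-- Closing a path into a cycle: Cauchy–Schwarz on pairs of end points, after integrating out the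
interior `y`. -/
theorem lintegral_mul_swap_lt_top {X Y : Type*} [MeasurableSpace X] [MeasurableSpace Y]
    {μ : Measure X} {π : Measure Y} [SigmaFinite μ] [SigmaFinite π] {a : (X × X) × Y → ℝ≥0∞}
    {b : X × X → ℝ≥0∞} (ha : Measurable a) (hb : Measurable b)
    (ha2 : ∫⁻ p, (∫⁻ y, a (p, y) ∂π) ^ 2 ∂μ.prod μ < ∞) (hb2 : ∫⁻ p, b p ^ 2 ∂μ.prod μ < ∞) :
    ∫⁻ q, a q * b q.1.swap ∂(μ.prod μ).prod π < ∞ := by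
  have hb' : Measurable fun p : X × X => b p.swap := hb.comp measurable_swap
  rw [lintegral_prod _ (by fun_prop)]
  have h2 : ∀ p : X × X, ∫⁻ y, a (p, y) * b p.swap ∂π = (∫⁻ y, a (p, y) ∂π) * b p.swap :=
    fun p => lintegral_mul_const _ (by fun_prop)
  simp only [h2]
  have h3 := sq_lintegral_mul_le (μ.prod μ) ha.lintegral_prod_right'.aemeasurable
    hb'.aemeasurable (f := fun p => ∫⁻ y, a (p, y) ∂π)
  rw [lintegral_prod_swap (fun p => b p ^ 2)] at h3
  exact (ENNReal.pow_lt_top_iff.1 (h3.trans_lt (ENNReal.mul_lt_top ha2 hb2))).resolve_right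
    two_ne_zero

theorem cyclicWeight_pathEquiv {F : Type*} [MeasurableSpace F] (g : F × F → ℂ) (m : ℕ)
    (q : (F × F) × (Fin m → F)) :
    cyclicWeight g (pathEquiv F m q) =
      pathWeight g (Fin.cons q.1.1 q.2 : Fin (m + 1) → F) q.1.2 * g q.1.swap := by
  rw [pathEquiv_apply, cyclicWeight_snoc]
  rfl

section Majorants

universe u

variable {H : Type u} [NormedAddCommGroup H] [InnerProductSpace ℂ H] [CompleteSpace H]

/-- The Hilbert--Schmidt norm as an extended nonnegative number. -/
def hsNorm (A : H →L[ℂ] H) : ℝ≥0∞ := hsNormSq A ^ (1 / 2 : ℝ)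

theorem hsNorm_sq (A : H →L[ℂ] H) : hsNorm A ^ 2 = hsNormSq A := by
  rw [hsNorm, ← ENNReal.rpow_natCast, ← ENNReal.rpow_mul]
  norm_num

theorem le_of_sq_le_sq {a b : ℝ≥0∞} (h : a ^ 2 ≤ b ^ 2) : a ≤ b :=
  (ENNReal.pow_le_pow_left_iff two_ne_zero).1 h

theorem hsNorm_mul_le (A B : H →L[ℂ] H) : hsNorm (A * B) ≤ hsNorm A * hsNorm B := by
  refine le_of_sq_le_sq ?_
  rw [mul_pow, hsNorm_sq, hsNorm_sq, hsNorm_sq]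
  exact hsNormSq_mul_le A B

theorem enorm_apply_le_hsNorm (A : H →L[ℂ] H) (h : H) : ‖A h‖ₑ ≤ hsNorm A * ‖h‖ₑ := by
  refine le_of_sq_le_sq ?_
  rw [mul_pow, hsNorm_sq]
  exact enorm_apply_sq_le A h

theorem traceNorm_mul_le (A B : H →L[ℂ] H) : traceNorm (A * B) ≤ hsNorm A * hsNorm B := by
  refine le_of_sq_le_sq ?_
  rw [mul_pow, hsNorm_sq, hsNorm_sq]
  exact sq_traceNorm_mul_le A B

theorem tsum_prod_inner_le {ι : Type*} (b : HilbertBasis ι ℂ H) (C D : H →L[ℂ] H) :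
    ∑' p : ι × ι, ‖⟪b p.1, C (b p.2)⟫_ℂ‖ₑ * ‖⟪b p.2, D (b p.1)⟫_ℂ‖ₑ ≤ hsNorm C * hsNorm D := by
  refine le_of_sq_le_sq ?_
  rw [mul_pow, hsNorm_sq, hsNorm_sq]
  exact sq_tsum_prod_inner_le b C D

variable {F : Type*}

/-- The scalar kernel `|g (x, σ)| ‖S x‖` with the Hilbert--Schmidt norm of `S x`. -/
def hsKernel (g : F × F → ℂ) (S : F → H →L[ℂ] H) (q : F × F) : ℝ≥0∞ := ‖g q‖ₑ * hsNorm (S q.1)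

/-- The product of the scalar kernels along a path. -/
def pathMajorant {n : ℕ} (g : F × F → ℂ) (S : F → H →L[ℂ] H) (z : Fin n → F) (σ : F) : ℝ≥0∞ :=
  ‖pathWeight g z σ‖ₑ * ∏ j, hsNorm (S (z j))

variable (g : F × F → ℂ) (S : F → H →L[ℂ] H)

theorem prod_hsNorm_snoc {n : ℕ} (z : Fin n → F) (s : F) :
    ∏ j, hsNorm (S ((Fin.snoc z s : Fin (n + 1) → F) j)) =
      (∏ j, hsNorm (S (z j))) * hsNorm (S s) := by
  rw [Fin.prod_univ_castSucc]
  simp [Fin.snoc_castSucc, Fin.snoc_last]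

theorem pathMajorant_zero (z : Fin 0 → F) (σ : F) : pathMajorant g S z σ = 1 := by
  simp [pathMajorant, pathWeight_zero]

theorem pathMajorant_snoc {n : ℕ} (z : Fin n → F) (s σ : F) :
    pathMajorant g S (Fin.snoc z s : Fin (n + 1) → F) σ =
      pathMajorant g S z s * hsKernel g S (s, σ) := by
  rw [pathMajorant, pathMajorant, hsKernel, prod_hsNorm_snoc, pathWeight_snoc, enorm_mul]
  ring

/-- At least one factor is needed, since the empty product is the identity; the trace norm bound
below likewise needs two. -/
theorem hsNorm_opProd_le {n : ℕ} (z : Fin (n + 1) → F) :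
    hsNorm (opProd S z) ≤ ∏ j, hsNorm (S (z j)) := by
  induction n with
  | zero =>
    rw [← Fin.snoc_init_self z, opProd_snoc, opProd_zero, mul_one, prod_hsNorm_snoc]
    simp
  | succ n ih =>
    rw [← Fin.snoc_init_self z, opProd_snoc, prod_hsNorm_snoc, mul_comm (∏ j, _)]
    exact (hsNorm_mul_le _ _).trans (by gcongr; exact ih _)

theorem traceNorm_opProd_le {n : ℕ} (z : Fin (n + 2) → F) :
    traceNorm (opProd S z) ≤ ∏ j, hsNorm (S (z j)) := by
  rw [← Fin.snoc_init_self z, opProd_snoc, prod_hsNorm_snoc, mul_comm (∏ j, _)]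
  exact (traceNorm_mul_le _ _).trans (by gcongr; exact hsNorm_opProd_le S _)

theorem enorm_powKernelIntegrand_le {m : ℕ} (x σ : F) (h : H) (y : Fin m → F) :
    ‖powKernelIntegrand g S x σ h y‖ₑ ≤
      pathMajorant g S (Fin.cons x y : Fin (m + 1) → F) σ * ‖h‖ₑ := by
  rw [powKernelIntegrand, pathMajorant, enorm_smul, mul_assoc]
  gcongr
  refine (enorm_apply_le_hsNorm _ _).trans ?_
  gcongr
  exact hsNorm_opProd_le S _

variable [MeasurableSpace F] {g S} {ν : Measure F} [SigmaFinite ν] {ι : Type*} [Countable ι]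

theorem measurable_hsNorm (e : HilbertBasis ι ℂ H)
    (hS : ∀ h, StronglyMeasurable fun x => S x h) : Measurable fun x => hsNorm (S x) := by
  let _ : MeasurableSpace ι := ⊤
  have : MeasurableSingletonClass ι := ⟨fun _ => trivial⟩
  exact (measurable_hsNormSq e hS).pow_const _

theorem measurable_hsKernel (e : HilbertBasis ι ℂ H) (hg : Measurable g)
    (hS : ∀ h, StronglyMeasurable fun x => S x h) : Measurable (hsKernel g S) :=
  hg.enorm.mul ((measurable_hsNorm e hS).comp measurable_fst)

theorem lintegral_hsKernel_sq (e : HilbertBasis ι ℂ H) (hg : Measurable g)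
    (hS : ∀ h, StronglyMeasurable fun x => S x h) :
    ∫⁻ q, hsKernel g S q ^ 2 ∂ν.prod ν = kernelIntegral ν g S := by
  rw [lintegral_prod _ ((measurable_hsKernel e hg hS).pow_const 2).aemeasurable, kernelIntegral]
  refine lintegral_congr fun x => ?_
  have h3 : Measurable fun σ => ‖g (x, σ)‖ₑ ^ 2 := by fun_prop
  simp only [hsKernel, mul_pow, hsNorm_sq]
  exact lintegral_mul_const (hsNormSq (S x)) h3

theorem measurable_pathMajorant (e : HilbertBasis ι ℂ H) (hg : Measurable g)
    (hS : ∀ h, StronglyMeasurable fun x => S x h) (m : ℕ) :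
    Measurable fun q : (F × F) × (Fin m → F) =>
      pathMajorant g S (Fin.cons q.1.1 q.2 : Fin (m + 1) → F) q.1.2 := by
  refine (measurable_pathWeight_cons hg m).enorm.mul (Finset.measurable_prod _ fun j _ => ?_)
  exact (measurable_hsNorm e hS).comp ((measurable_pi_apply j).comp (measurable_cons m))

/-- The integral of the majorants of the paths from `x` to `σ`. -/
def majorantKernel (ν : Measure F) (g : F × F → ℂ) (S : F → H →L[ℂ] H) (m : ℕ) (q : F × F) : ℝ≥0∞ :=
  ∫⁻ y : Fin m → F, pathMajorant g S (Fin.cons q.1 y : Fin (m + 1) → F) q.2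
    ∂Measure.pi fun _ => ν

theorem measurable_majorantKernel (e : HilbertBasis ι ℂ H) (hg : Measurable g)
    (hS : ∀ h, StronglyMeasurable fun x => S x h) (m : ℕ) :
    Measurable (majorantKernel ν g S m) :=
  (measurable_pathMajorant e hg hS m).lintegral_prod_right'

theorem majorantKernel_zero (q : F × F) : majorantKernel ν g S 0 q = hsKernel g S q := by
  rw [majorantKernel, Measure.pi_of_empty, lintegral_dirac, cons_eq_snoc, pathMajorant_snoc,
    pathMajorant_zero, one_mul]

/-- Splitting off the last interior point shows that the majorants iterate like composed kernels, so
their L² bounds follow by induction. -/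
theorem majorantKernel_succ (e : HilbertBasis ι ℂ H) (hg : Measurable g)
    (hS : ∀ h, StronglyMeasurable fun x => S x h) (m : ℕ) (q : F × F) :
    majorantKernel ν g S (m + 1) q =
      ∫⁻ s, majorantKernel ν g S m (q.1, s) * hsKernel g S (s, q.2) ∂ν := by
  have hm := measurable_pathMajorant e hg hS m
  have hκ := measurable_hsKernel e hg hS
  rw [majorantKernel, ← (measurePreserving_snocEquiv ν m).lintegral_comp_emb
    (snocEquiv F m).measurableEmbedding]
  simp only [snocEquiv_apply, Fin.cons_snoc_eq_snoc_cons, pathMajorant_snoc]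
  have h1 : Measurable fun p : (Fin m → F) × F =>
      pathMajorant g S (Fin.cons q.1 p.1 : Fin (m + 1) → F) p.2 :=
    hm.comp (f := fun p : (Fin m → F) × F => ((q.1, p.2), p.1)) (by fun_prop)
  have h2 : Measurable fun p : (Fin m → F) × F => hsKernel g S (p.2, q.2) :=
    hκ.comp (by fun_prop)
  have h3 : Measurable fun p : (Fin m → F) × F =>
      pathMajorant g S (Fin.cons q.1 p.1 : Fin (m + 1) → F) p.2 * hsKernel g S (p.2, q.2) :=
    h1.mul h2
  rw [lintegral_prod_symm _ h3.aemeasurable]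
  refine lintegral_congr fun s => ?_
  exact lintegral_mul_const (hsKernel g S (s, q.2)) (h1.comp (measurable_prodMk_right (y := s)))

theorem lintegral_majorantKernel_sq_lt_top (e : HilbertBasis ι ℂ H) (hg : Measurable g)
    (hS : ∀ h, StronglyMeasurable fun x => S x h) (hk : kernelIntegral ν g S < ∞) (m : ℕ) :
    ∫⁻ q, majorantKernel ν g S m q ^ 2 ∂ν.prod ν < ∞ := by
  rw [← lintegral_hsKernel_sq e hg hS] at hk
  induction m with
  | zero => simpa only [majorantKernel_zero] using hk
  | succ m ih =>
    simp only [majorantKernel_succ e hg hS]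
    exact (lintegral_sq_lintegral_mul_le (measurable_majorantKernel e hg hS m)
      (measurable_hsKernel e hg hS)).trans_lt (ENNReal.mul_lt_top ih hk)

theorem ae_integrable_powKernelIntegrand (e : HilbertBasis ι ℂ H) (hg : Measurable g)
    (hS : ∀ h, StronglyMeasurable fun x => S x h) (hk : kernelIntegral ν g S < ∞) (m : ℕ) (h : H) :
    ∀ᵐ q ∂ν.prod ν, Integrable (fun y : Fin m → F => powKernelIntegrand g S q.1 q.2 h y)
      (Measure.pi fun _ => ν) := by
  filter_upwards [ae_lt_top ((measurable_majorantKernel e hg hS m).pow_const 2)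
    (lintegral_majorantKernel_sq_lt_top (ν := ν) e hg hS hk m).ne] with q hq
  refine ⟨((stronglyMeasurable_powKernelIntegrand e hg hS m h).comp_measurable
    measurable_prodMk_left).aestronglyMeasurable, ?_⟩
  refine (lintegral_mono fun y => enorm_powKernelIntegrand_le g S q.1 q.2 h y).trans_lt ?_
  rw [lintegral_mul_const' _ _ enorm_lt_top.ne]
  exact ENNReal.mul_lt_top ((ENNReal.pow_lt_top_iff.1 hq).resolve_right two_ne_zero) enorm_lt_top

theorem lintegral_cyclic_majorant_lt_top (e : HilbertBasis ι ℂ H) (hg : Measurable g)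
    (hS : ∀ h, StronglyMeasurable fun x => S x h) (hk : kernelIntegral ν g S < ∞) (m : ℕ) :
    ∫⁻ q : (F × F) × (Fin m → F), pathMajorant g S (Fin.cons q.1.1 q.2 : Fin (m + 1) → F) q.1.2 *
      hsKernel g S q.1.swap ∂(ν.prod ν).prod (Measure.pi fun _ => ν) < ∞ :=
  lintegral_mul_swap_lt_top (measurable_pathMajorant e hg hS m) (measurable_hsKernel e hg hS)
    (lintegral_majorantKernel_sq_lt_top e hg hS hk m)
    ((lintegral_hsKernel_sq e hg hS).trans_lt hk)

theorem ae_isTraceClass_opProd (e : HilbertBasis ι ℂ H) (hg : Measurable g)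
    (hS : ∀ h, StronglyMeasurable fun x => S x h)
    (hk : kernelIntegral ν g S < ∞) (m : ℕ) :
    ∀ᵐ z : Fin (m + 2) → F ∂Measure.pi fun _ => ν, cyclicWeight g z ≠ 0 →
      IsTraceClass (opProd S z) := by
  have hE := measurePreserving_pathEquiv ν m
  rw [← hE.map_eq, (pathEquiv F m).measurableEmbedding.ae_map_iff]
  have hκ := measurable_hsKernel e hg hS
  have hm : Measurable fun q : (F × F) × (Fin m → F) =>
      pathMajorant g S (Fin.cons q.1.1 q.2 : Fin (m + 1) → F) q.1.2 * hsKernel g S q.1.swap :=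
    (measurable_pathMajorant e hg hS m).mul (hκ.comp (measurable_swap.comp measurable_fst))
  filter_upwards [ae_lt_top hm (lintegral_cyclic_majorant_lt_top (ν := ν) e hg hS hk m).ne]
    with q hq hc
  -- The majorant is the absolute cyclic weight times the product of Hilbert–Schmidt norms. With
  -- nonzero weight, an infinite product would make it infinite.
  refine (traceNorm_opProd_le S _).trans_lt (lt_top_iff_ne_top.2 fun htop => hq.ne ?_)
  have h1 : pathMajorant g S (Fin.cons q.1.1 q.2 : Fin (m + 1) → F) q.1.2 * hsKernel g S q.1.swap =
      ‖cyclicWeight g (pathEquiv F m q)‖ₑ * ∏ j, hsNorm (S (pathEquiv F m q j)) := by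
    rw [cyclicWeight_pathEquiv, pathEquiv_apply, prod_hsNorm_snoc, pathMajorant, hsKernel,
      Prod.fst_swap, enorm_mul]
    ring
  rw [h1, htop, ENNReal.mul_top (by simpa using hc)]

end Majorants

/-! ### Powers -/


section Powers

variable {F ι : Type*} [MeasurableSpace F] {ν : Measure F} [SigmaFinite ν]
  [MeasurableSpace ι] [MeasurableSingletonClass ι] [Countable ι]
  {H : Type*} [NormedAddCommGroup H] [InnerProductSpace ℂ H] [CompleteSpace H]
  (e : HilbertBasis ι ℂ H) {g : F × F → ℂ} {S : F → H →L[ℂ] H}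

/-- The columns of the operator valued kernel of the `m + 1`-st power. -/
def powColumns (ν : Measure F) (g : F × F → ℂ) (S : F → H →L[ℂ] H) (m : ℕ) (q : F × F) (i : ι) :
    H :=
  ∫ y : Fin m → F, powKernelIntegrand g S q.1 q.2 (e i) y ∂Measure.pi fun _ => ν

theorem powColumns_zero : powColumns e ν g S 0 = columns e g S := by
  funext q i
  rw [powColumns, Measure.pi_of_empty, integral_dirac, powKernelIntegrand_zero, columns]

theorem stronglyMeasurable_powColumns (hg : Measurable g)
    (hS : ∀ h, StronglyMeasurable fun x => S x h) (m : ℕ) (i : ι) :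
    StronglyMeasurable fun q => powColumns e ν g S m q i :=
  (stronglyMeasurable_powKernelIntegrand e hg hS m (e i)).integral_prod_right'

/-- Fubini separates the last interior point `s`, and for almost every `s` the bounded operator `g
(s, σ) • S s` passes out of the remaining integral. -/
theorem powColumns_succ (hg : Measurable g) (hS : ∀ h, StronglyMeasurable fun x => S x h)
    (hk : kernelIntegral ν g S < ∞) (m : ℕ) (i : ι) (w : H) :
    ∀ᵐ q ∂ν.prod ν, ⟪w, powColumns e ν g S (m + 1) q i⟫_ℂ =
      ∫ s, ⟪w, (g (s, q.2) • S s) (powColumns e ν g S m (q.1, s) i)⟫_ℂ ∂ν := by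
  have h1 : ∀ᵐ q : F × F ∂ν.prod ν, ∀ᵐ s ∂ν, Integrable
      (fun y : Fin m → F => powKernelIntegrand g S q.1 s (e i) y) (Measure.pi fun _ => ν) :=
    Measure.quasiMeasurePreserving_fst.ae
      (Measure.ae_ae_of_ae_prod (ae_integrable_powKernelIntegrand e hg hS hk m (e i)))
  filter_upwards [ae_integrable_powKernelIntegrand (ν := ν) e hg hS hk (m + 1) (e i), h1]
    with q h2 h3
  have h4 := measurePreserving_snocEquiv ν m
  have h5 := (h4.integrable_comp_emb (snocEquiv F m).measurableEmbedding).2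
    (h2.const_inner (𝕜 := ℂ) w)
  rw [powColumns, ← integral_inner h2,
    ← h4.integral_comp (snocEquiv F m).measurableEmbedding, integral_prod_symm
      (fun p => ⟪w, powKernelIntegrand g S q.1 q.2 (e i) (snocEquiv F m p)⟫_ℂ) h5]
  refine integral_congr_ae ?_
  filter_upwards [h3] with s hs
  simp only [snocEquiv_apply, powKernelIntegrand_snoc]
  rw [integral_inner ((g (s, q.2) • S s).integrable_comp hs),
    ContinuousLinearMap.integral_comp_comm _ hs]
  rfl

theorem isKernel_pow (hg : Measurable g) (hS : ∀ h, StronglyMeasurable fun x => S x h)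
    (hk : kernelIntegral ν g S < ∞)
    {T : Lp ℂ 2 (ν.prod (Measure.count : Measure ι)) →L[ℂ]
      Lp ℂ 2 (ν.prod (Measure.count : Measure ι))}
    (hT : IsKernel (entries e (columns e g S)) T) (m : ℕ) :
    IsKernel (entries e (powColumns e ν g S m)) (T ^ (m + 1)) := by
  induction m with
  | zero => rwa [powColumns_zero, zero_add, pow_one]
  | succ m ih =>
    rw [pow_succ']
    refine (ih.mul hT).congr (measurable_entries e (stronglyMeasurable_powColumns e hg hS (m + 1)))
      (ae_exchange_iff.2 fun i j => ?_)
    filter_upwards [powColumns_succ e hg hS hk m i (e j),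
      ae_exchange_iff.1 (ae_integrable_compKernel ih.measurable hT.measurable
          ih.memLp hT.memLp) i j]
      with q h1 h2
    have h3 : (fun r : F × ι => entries e (powColumns e ν g S m) ((q.1, i), r) *
        entries e (columns e g S) (r, (q.2, j))) = fun p : F × ι =>
        ⟪e j, (g (p.1, q.2) • S p.1) (e p.2)⟫_ℂ * ⟪e p.2, powColumns e ν g S m (q.1, p.1) i⟫_ℂ := by
      funext r
      rw [mul_comm]
      rfl
    rw [compKernel, h3, integral_inner_apply_mul e (A := fun s => g (s, q.2) • S s)
      (v := fun s => powColumns e ν g S m (q.1, s) i) (h3 ▸ h2), ← h1]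
    rfl

/-! ### Traces -/

/-- The terms of the expansion of the trace of a power with respect to an orthonormal basis. -/
def traceTerm (g : F × F → ℂ) (S : F → H →L[ℂ] H) (m : ℕ)
    (q : ((F × F) × (Fin m → F)) × (ι × ι)) : ℂ :=
  ⟪e q.2.2, powKernelIntegrand g S q.1.1.1 q.1.1.2 (e q.2.1) q.1.2⟫_ℂ *
    ⟪e q.2.1, (g (q.1.1.2, q.1.1.1) • S q.1.1.2) (e q.2.2)⟫_ℂ

theorem measurable_traceTerm (hg : Measurable g) (hS : ∀ h, StronglyMeasurable fun x => S x h)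
    (m : ℕ) : Measurable (traceTerm e g S m) := by
  refine measurable_from_prod_countable_left fun p => ?_
  have h1 : StronglyMeasurable fun q : (F × F) × (Fin m → F) =>
      ⟪e p.2, powKernelIntegrand g S q.1.1 q.1.2 (e p.1) q.2⟫_ℂ :=
    stronglyMeasurable_const.inner (stronglyMeasurable_powKernelIntegrand e hg hS m (e p.1))
  have h2 : StronglyMeasurable fun q : (F × F) × (Fin m → F) =>
      ⟪e p.1, g (q.1.2, q.1.1) • S q.1.2 (e p.2)⟫_ℂ :=
    stronglyMeasurable_const.inner ((hg.comp (f := fun q : (F × F) × (Fin m → F) => (q.1.2, q.1.1))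
      (by fun_prop)).stronglyMeasurable.smul ((hS (e p.2)).comp_measurable (by fun_prop)))
  exact (h1.mul h2).measurable

theorem tsum_enorm_traceTerm_le (m : ℕ) (q : (F × F) × (Fin m → F)) :
    ∑' p : ι × ι, ‖traceTerm e g S m (q, p)‖ₑ ≤
      pathMajorant g S (Fin.cons q.1.1 q.2 : Fin (m + 1) → F) q.1.2 *
        hsKernel g S q.1.swap := by
  set R := opProd S (Fin.cons q.1.1 q.2 : Fin (m + 1) → F)
  set a := pathWeight g (Fin.cons q.1.1 q.2 : Fin (m + 1) → F) q.1.2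
  have h1 : ∀ p : ι × ι, ‖traceTerm e g S m (q, p)‖ₑ = ‖a‖ₑ * ‖g q.1.swap‖ₑ *
      (‖⟪e p.1, S q.1.2 (e p.2)⟫_ℂ‖ₑ * ‖⟪e p.2, R (e p.1)⟫_ℂ‖ₑ) := fun p => by
    rw [traceTerm, powKernelIntegrand, inner_smul_right, smul_apply, inner_smul_right, enorm_mul,
      enorm_mul, enorm_mul]
    change ‖a‖ₑ * ‖⟪e p.2, R (e p.1)⟫_ℂ‖ₑ * (‖g q.1.swap‖ₑ * ‖⟪e p.1, S q.1.2 (e p.2)⟫_ℂ‖ₑ) = _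
    ring
  simp only [h1]
  rw [ENNReal.tsum_mul_left]
  calc _ ≤ ‖a‖ₑ * ‖g q.1.swap‖ₑ * (hsNorm (S q.1.2) *
        ∏ j, hsNorm (S ((Fin.cons q.1.1 q.2 : Fin (m + 1) → F) j))) := by
        gcongr
        refine (tsum_prod_inner_le e (S q.1.2) R).trans ?_
        gcongr
        exact hsNorm_opProd_le S _
    _ = _ := by
        rw [pathMajorant, hsKernel, Prod.fst_swap]
        ring

theorem integrable_traceTerm (hg : Measurable g) (hS : ∀ h, StronglyMeasurable fun x => S x h)
    (hk : kernelIntegral ν g S < ∞) (m : ℕ) :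
    Integrable (traceTerm e g S m)
      (((ν.prod ν).prod (Measure.pi fun _ => ν)).prod Measure.count) := by
  have hm := measurable_traceTerm e hg hS m
  refine ⟨hm.aestronglyMeasurable, ?_⟩
  rw [HasFiniteIntegral, lintegral_prod_count' fun p =>
    (hm.enorm.comp (measurable_prodMk_right (y := p))).aemeasurable]
  exact (lintegral_mono fun q => tsum_enorm_traceTerm_le e m q).trans_lt
    (lintegral_cyclic_majorant_lt_top e hg hS hk m)

/-- Almost everywhere the double series converges absolutely; Parseval removes the sum over the
second index and the first gives the trace. The hypothesis `he` restricts to a basis known to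
compute `opTrace`. -/
theorem ae_cyclicWeight_mul_opTrace (hg : Measurable g)
    (hS : ∀ h, StronglyMeasurable fun x => S x h) (hk : kernelIntegral ν g S < ∞) (m : ℕ)
    (he : ∀ A : H →L[ℂ] H, opTrace A = ∑' i, ⟪e i, A (e i)⟫_ℂ) :
    ∀ᵐ q : (F × F) × (Fin m → F) ∂(ν.prod ν).prod (Measure.pi fun _ => ν),
      ∫ p, traceTerm e g S m (q, p) ∂Measure.count =
        cyclicWeight g (pathEquiv F m q) * opTrace (opProd S (pathEquiv F m q)) := by
  filter_upwards [(integrable_traceTerm (ν := ν) e hg hS hk m).prod_right_ae] with q hq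
  have hsum : Summable fun p => traceTerm e g S m (q, p) := by
    rw [integrable_count_iff] at hq
    exact hq.of_norm
  rw [integral_count_eq_tsum hq, hsum.tsum_prod, he, cyclicWeight_pathEquiv, ← tsum_mul_left]
  refine tsum_congr fun i => ?_
  set R := opProd S (Fin.cons q.1.1 q.2 : Fin (m + 1) → F) with hR
  set a := pathWeight g (Fin.cons q.1.1 q.2 : Fin (m + 1) → F) q.1.2 with ha
  have h1 : ∀ j, traceTerm e g S m (q, (i, j)) = a * g q.1.swap *
      (⟪ContinuousLinearMap.adjoint (S q.1.2) (e i), e j⟫_ℂ * ⟪e j, R (e i)⟫_ℂ) := fun j => by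
    rw [ContinuousLinearMap.adjoint_inner_left, traceTerm, powKernelIntegrand, inner_smul_right,
      smul_apply, inner_smul_right]
    change a * ⟪e j, R (e i)⟫_ℂ * (g q.1.swap * ⟪e i, S q.1.2 (e j)⟫_ℂ) = _
    ring
  simp only [h1]
  rw [tsum_mul_left, e.tsum_inner_mul_inner, ContinuousLinearMap.adjoint_inner_left,
    pathEquiv_apply, opProd_snoc, mul_apply_eq_comp]

theorem integrable_cyclicWeight_mul_opTrace (hg : Measurable g)
    (hS : ∀ h, StronglyMeasurable fun x => S x h) (hk : kernelIntegral ν g S < ∞) (m : ℕ)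
    (he : ∀ A : H →L[ℂ] H, opTrace A = ∑' i, ⟪e i, A (e i)⟫_ℂ) :
    Integrable (fun z : Fin (m + 2) → F => cyclicWeight g z * opTrace (opProd S z))
      (Measure.pi fun _ => ν) := by
  rw [← (measurePreserving_pathEquiv ν m).integrable_comp_emb (pathEquiv F m).measurableEmbedding]
  exact (integrable_traceTerm e hg hS hk m).integral_prod_left.congr
    (ae_cyclicWeight_mul_opTrace e hg hS hk m he)

theorem integral_cyclicWeight_mul_opTrace (hg : Measurable g)
    (hS : ∀ h, StronglyMeasurable fun x => S x h) (hk : kernelIntegral ν g S < ∞) (m : ℕ)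
    (he : ∀ A : H →L[ℂ] H, opTrace A = ∑' i, ⟪e i, A (e i)⟫_ℂ)
    {T : Lp ℂ 2 (ν.prod (Measure.count : Measure ι)) →L[ℂ]
      Lp ℂ 2 (ν.prod (Measure.count : Measure ι))}
    (hT : IsKernel (entries e (columns e g S)) T) :
    ∫ z : Fin (m + 2) → F, cyclicWeight g z * opTrace (opProd S z) ∂(Measure.pi fun _ => ν) =
      ∫ p, entries e (powColumns e ν g S m) p * entries e (columns e g S) p.swap
        ∂(ν.prod Measure.count).prod (ν.prod Measure.count) := by
  have hΦ := integrable_traceTerm (ν := ν) e hg hS hk m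
  have hassoc : MeasurePreserving
      (MeasurableEquiv.prodAssoc : ((F × F) × (Fin m → F)) × (ι × ι) ≃ᵐ _)
      (((ν.prod ν).prod (Measure.pi fun _ => ν)).prod Measure.count)
      ((ν.prod ν).prod ((Measure.pi fun _ => ν).prod Measure.count)) :=
    measurePreserving_prodAssoc _ _ _
  have hassoc' := hassoc.symm _
  have hΦ' := (hassoc'.integrable_comp_emb
    MeasurableEquiv.prodAssoc.symm.measurableEmbedding).2 hΦ
  have hex : MeasurePreserving (exchangeEquiv F ι F ι) _ _ := measurePreserving_exchangeEquiv ν ν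
  have hint := (hex.integrable_comp_emb (exchangeEquiv F ι F ι).measurableEmbedding).2
    (hT.integrable_mul_swap (isKernel_pow e hg hS hk hT m))
  have h1 : ∀ᵐ q ∂ν.prod ν, ∀ i, Integrable (fun y : Fin m → F =>
      powKernelIntegrand g S q.1 q.2 (e i) y) (Measure.pi fun _ => ν) :=
    ae_all_iff.2 fun i => ae_integrable_powKernelIntegrand e hg hS hk m (e i)
  -- Both sides become integrals over end points and index pairs. On the left, reassociating the
  -- product lets the interior path be integrated first, which produces the entries of `powColumns`.
  rw [← (measurePreserving_pathEquiv ν m).integral_comp (pathEquiv F m).measurableEmbedding,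
    ← integral_congr_ae (ae_cyclicWeight_mul_opTrace (ν := ν) e hg hS hk m he),
    ← integral_prod _ hΦ, ← hassoc'.integral_comp
      MeasurableEquiv.prodAssoc.symm.measurableEmbedding, integral_prod
      (fun x => traceTerm e g S m (MeasurableEquiv.prodAssoc.symm x)) hΦ',
    ← hex.integral_comp (exchangeEquiv F ι F ι).measurableEmbedding, integral_prod
      (fun x => entries e (powColumns e ν g S m) (exchangeEquiv F ι F ι x) *
        entries e (columns e g S) (exchangeEquiv F ι F ι x).swap) hint]
  refine integral_congr_ae ?_
  filter_upwards [h1, hΦ'.prod_right_ae] with q h2 h3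
  rw [integral_prod_symm
    (fun y => traceTerm e g S m (MeasurableEquiv.prodAssoc.symm (q, y))) h3]
  refine integral_congr_ae (ae_of_all _ fun p => ?_)
  change ∫ y : Fin m → F, ⟪e p.2, powKernelIntegrand g S q.1 q.2 (e p.1) y⟫_ℂ *
    ⟪e p.1, (g (q.2, q.1) • S q.2) (e p.2)⟫_ℂ ∂(Measure.pi fun _ => ν) = _
  rw [integral_mul_const, integral_inner (h2 p.1)]
  rfl

end Powers

/-! ### Consequences for the operators on the tensor product -/

section Conclusion

variable {F ι : Type*} [MeasurableSpace F] {ν : Measure F} [SigmaFinite ν] [Countable ι]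
  {H : Type*} [NormedAddCommGroup H] [InnerProductSpace ℂ H] [CompleteSpace H]
  {g : F × F → ℂ} {S : F → H →L[ℂ] H}

theorem hsNormSq_eq_kernelIntegral (e : HilbertBasis ι ℂ H) (hg : Measurable g)
    (hS : ∀ h, StronglyMeasurable fun x => S x h) {T : L2Tensor ν H →L[ℂ] L2Tensor ν H}
    (hT : IsGivenBy ν g S T) (hHS : IsHilbertSchmidt T) :
    hsNormSq T = kernelIntegral ν g S := by
  let _ : MeasurableSpace ι := ⊤
  have : MeasurableSingletonClass ι := ⟨fun _ => trivial⟩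
  rw [← hsNormSq_transport (tensorEquiv ν e),
    (isKernel_of_isGivenBy e hg hS hT hHS).hsNormSq_eq, lintegral_columns e hg hS]

theorem exists_isGivenBy (e : HilbertBasis ι ℂ H) (hg : Measurable g)
    (hS : ∀ h, StronglyMeasurable fun x => S x h) (hk : kernelIntegral ν g S < ∞) :
    ∃ T : L2Tensor ν H →L[ℂ] L2Tensor ν H, IsGivenBy ν g S T ∧ IsHilbertSchmidt T := by
  let _ : MeasurableSpace ι := ⊤
  have : MeasurableSingletonClass ι := ⟨fun _ => trivial⟩
  obtain ⟨T, hT, hTk⟩ := exists_isKernel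
    (measurable_entries e (stronglyMeasurable_columns e hg hS)) (memLp_columns e hg hS hk)
  refine ⟨transport (tensorEquiv ν e).symm T, isGivenBy_of_isKernel e hg hS hk ?_,
    (isHilbertSchmidt_transport _ T).2 hT⟩
  rwa [transport_symm]

theorem hsNormSq_pow (e : HilbertBasis ι ℂ H) (hg : Measurable g)
    (hS : ∀ h, StronglyMeasurable fun x => S x h) {T : L2Tensor ν H →L[ℂ] L2Tensor ν H}
    (hT : IsGivenBy ν g S T) (hHS : IsHilbertSchmidt T) (m : ℕ) :
    hsNormSq (T ^ (m + 1)) = ∫⁻ σ, ∫⁻ x, ∑' i, ‖∫ y : Fin m → F,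
      powKernelIntegrand g S x σ (e i) y ∂Measure.pi fun _ => ν‖ₑ ^ 2 ∂ν ∂ν := by
  let _ : MeasurableSpace ι := ⊤
  have : MeasurableSingletonClass ι := ⟨fun _ => trivial⟩
  have hk : kernelIntegral ν g S < ∞ := by rwa [← hsNormSq_eq_kernelIntegral e hg hS hT hHS]
  have hm := stronglyMeasurable_powColumns (ν := ν) e hg hS m
  rw [← hsNormSq_transport (tensorEquiv ν e), transport_pow,
    (isKernel_pow e hg hS hk (isKernel_of_isGivenBy e hg hS hT hHS) m).hsNormSq_eq,
    lintegral_entries e hm,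
    lintegral_prod_symm _ (Measurable.tsum fun i => (hm i).enorm.pow_const 2).aemeasurable]
  rfl

theorem opTrace_pow (hι : Countable (BasisIndex H)) (hg : Measurable g)
    (hS : ∀ h, StronglyMeasurable fun x => S x h) {T : L2Tensor ν H →L[ℂ] L2Tensor ν H}
    (hT : IsGivenBy ν g S T) (hHS : IsHilbertSchmidt T) (m : ℕ) :
    Integrable (fun z : Fin (m + 2) → F => cyclicWeight g z * opTrace (opProd S z))
      (Measure.pi fun _ => ν) ∧
    opTrace (T ^ (m + 2)) =
      ∫ z : Fin (m + 2) → F, cyclicWeight g z * opTrace (opProd S z) ∂Measure.pi fun _ => ν := by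
  let _ : MeasurableSpace (BasisIndex H) := ⊤
  have : MeasurableSingletonClass (BasisIndex H) := ⟨fun _ => trivial⟩
  have hk : kernelIntegral ν g S < ∞ := by
    rwa [← hsNormSq_eq_kernelIntegral (stdBasis H) hg hS hT hHS]
  have hK := isKernel_of_isGivenBy (stdBasis H) hg hS hT hHS
  refine ⟨integrable_cyclicWeight_mul_opTrace (stdBasis H) hg hS hk m fun _ => rfl, ?_⟩
  rw [integral_cyclicWeight_mul_opTrace (stdBasis H) hg hS hk m (fun _ => rfl) hK,
    ← (hK.hasSum_inner_mul (isKernel_pow (stdBasis H) hg hS hk hK m)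
      (mapBasis (tensorEquiv ν (stdBasis H)) (stdBasis _))).tsum_eq,
    opTrace_eq_tsum_transport (tensorEquiv ν (stdBasis H)), transport_pow]
  simp only [← pow_succ']

end Conclusion

end KernelTrace

end

/-! ### Assembly of the four statements -/

theorem lemma1p5 {F : Type*} [MeasurableSpace F] (ν : MeasureTheory.Measure F)
    [MeasureTheory.SigmaFinite ν]
    {H : Type*} [NormedAddCommGroup H] [InnerProductSpace ℂ H] [CompleteSpace H]
    [TopologicalSpace.SeparableSpace H]
    (g : F × F → ℂ) (hg : Measurable g)
    (S : F → H →L[ℂ] H) (hS : KernelTrace.MeasurableFamily S) :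
    ((∃ T : KernelTrace.L2Tensor ν H →L[ℂ] KernelTrace.L2Tensor ν H,
        KernelTrace.IsGivenBy ν g S T ∧ KernelTrace.IsHilbertSchmidt T) ↔
      KernelTrace.kernelIntegral ν g S < ∞) ∧
    ∀ T : KernelTrace.L2Tensor ν H →L[ℂ] KernelTrace.L2Tensor ν H,
      KernelTrace.IsGivenBy ν g S T → KernelTrace.IsHilbertSchmidt T →
      KernelTrace.hsNormSq T = KernelTrace.kernelIntegral ν g S ∧
      (∀ n : ℕ, 2 ≤ n →
        KernelTrace.IsTraceClass (T ^ n) ∧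
        (∀ᵐ x : Fin n → F ∂MeasureTheory.Measure.pi fun _ => ν,
          KernelTrace.cyclicWeight g x ≠ 0 →
            KernelTrace.IsTraceClass (KernelTrace.opProd S x)) ∧
        MeasureTheory.Integrable (fun x : Fin n → F =>
          KernelTrace.cyclicWeight g x * KernelTrace.opTrace (KernelTrace.opProd S x))
          (MeasureTheory.Measure.pi fun _ => ν) ∧
        KernelTrace.opTrace (T ^ n) =
          ∫ x : Fin n → F, KernelTrace.cyclicWeight g x *
            KernelTrace.opTrace (KernelTrace.opProd S x)
            ∂MeasureTheory.Measure.pi fun _ => ν) ∧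
      (∀ m : ℕ, 1 ≤ m →
        KernelTrace.IsHilbertSchmidt (T ^ (m + 1)) ∧
        ∀ {ι : Type*} (b : HilbertBasis ι ℂ H),
          (∀ i, ∀ᵐ p : F × F ∂ν.prod ν, MeasureTheory.Integrable
            (fun y : Fin m → F => KernelTrace.powKernelIntegrand g S p.1 p.2 (b i) y)
            (MeasureTheory.Measure.pi fun _ => ν)) ∧
          KernelTrace.hsNormSq (T ^ (m + 1)) =
            ∫⁻ σ, ∫⁻ x, ∑' i, ‖∫ y : Fin m → F,
              KernelTrace.powKernelIntegrand g S x σ (b i) y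
              ∂MeasureTheory.Measure.pi fun _ => ν‖ₑ ^ 2 ∂ν ∂ν) := by
  have hι : Countable (KernelTrace.BasisIndex H) :=
    (KernelTrace.stdBasis H).orthonormal.countable_of_separableSpace
  have hSm : ∀ h, MeasureTheory.StronglyMeasurable fun x => S x h := fun h =>
    KernelTrace.stronglyMeasurable_of_coordinates (KernelTrace.stdBasis H) fun i => hS _ _
  have e := KernelTrace.stdBasis H
  refine ⟨⟨fun ⟨T, hT, hHS⟩ => ?_, KernelTrace.exists_isGivenBy e hg hSm⟩, fun T hT hHS => ?_⟩
  · rwa [← KernelTrace.hsNormSq_eq_kernelIntegral e hg hSm hT hHS]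
  have hk := KernelTrace.hsNormSq_eq_kernelIntegral e hg hSm hT hHS
  have hk' : KernelTrace.kernelIntegral ν g S < ⊤ := hk ▸ hHS
  refine ⟨hk, fun n hn => ?_, fun m _ => ⟨hHS.pow m, fun {ι} b => ?_⟩⟩
  · obtain ⟨m, rfl⟩ := Nat.exists_eq_add_of_le' hn
    refine ⟨?_, KernelTrace.ae_isTraceClass_opProd e hg hSm hk' m,
      KernelTrace.opTrace_pow hι hg hSm hT hHS m⟩
    -- `T ^ (m + 2)` is the product of the Hilbert–Schmidt operators `T ^ (m + 1)` and `T`.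
    rw [pow_succ]
    exact (hHS.pow m).isTraceClass_mul hHS
  · have hb : Countable ι := b.orthonormal.countable_of_separableSpace
    exact ⟨fun i => KernelTrace.ae_integrable_powKernelIntegrand b hg hSm hk' m (b i),
      KernelTrace.hsNormSq_pow b hg hSm hT hHS m⟩
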